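/- **Index coding inner bound.** Messages are indexed by a finite set $I$; user $j$ knows the messages in $\mathcal A_j\subseteq I$ and wants those in $\mathcal D_j\subseteq I$; the noiseless broadcast channel has alphabet $\mathcal X$. Let $\mathscr R(\mathcal X)$ be the set of non-negative rate tuples $(R_i)_{i\in I}$ (bits per channel use) for which there are independent finite-alphabet random variables $(U_i)_{i\in I}$ and functions $X_{\mathcal P}=f_{\mathcal P}((U_i)_{i\in\mathcal P})$, $\mathcal P\subseteq I$, such that, with $X=(X_{\mathcal P})_{\mathcal P\subseteq I}$, for every user $j$: $H(X\mid (U_i)_{i\in\mathcal A_j})\le\log_2|\mathcal X|$, and there is $\mathcal K_j$ with $\mathcal D_j\subseteq\mathcal K_j\subseteq I\setminus\mathcal A_j$ such that $$\sum_{i\in\mathcal J}R_i< I\big((U_i)_{i\in\mathcal J};X\,\big|\,(U_i)_{i\in\mathcal A_j\cup(\mathcal K_j\setminus\mathcal J)}\big)\quad\text{for all }\mathcal J\subseteq\mathcal K_j\text{ with }\mathcal J\cap\mathcal D_j\ne\emptyset .$$ **Caching.** A server has $N\ge1$ independent files of $B$ uniform bits; $K\ge1$ users have caches of $MB$ bits,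 filled with copies of file bits (uncoded placement) before the demands $\mathbf d\in[1:N]^K$ are revealed. For given caches and demands let $F_{i,\mathcal W}$ be the set of bits of file $i$ cached by exactly the users in $\mathcal W\subseteq[1:K]$. Delivery is the index coding problem whose messages are the non-empty $F_{i,\mathcal W}$ with $i$ demanded, where user $k$ knows those with $k\in\mathcal W$ and wants those with $i=d_k$, $k\notin\mathcal W$. The inner bound *delivers $\mathbf d$ with load $\rho$* if for every $r>\rho$ there is $m\ge1$ such that the rates $R_{i,\mathcal W}=|F_{i,\mathcal W}|\,m/(rB)$ lie in $\mathscr R(\mathcal X)$ with $|\mathcal X|=2^m$ (that is, $rB/m$ channel uses of $m$ bits each). A worst-case load $R$ is *achievable* under centralized uncoded placement if for every $\varepsilon>0$ and all large $B$ there is an uncoded placement such that every demand vector is served by a broadcast of at most $RB$ bits with error probability at most $\varepsilon$. Under decentralized uncoded placement the caches are instead drawn independently by the users from a common distribution, and the error probability is also averaged over the placement. The optimal load is the infimum of the achievable loads. **Theorem.** (a) *Centralized.* Let $t\in[0:K]$, $M=tN/K$ and $$\rho=\frac{\binom{K}{t+1}-\binom{K-\min(K,N)}{t+1}}{\binom Kt}.$$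 If $B\geq 1$ is a multiple of $\binom Kt$, there is a placement with caches of at most $MB$ bits, in which each file is split into $\binom Kt$ equal parts, one for each set of $t$ users and cached by exactly these users, such that the inner bound delivers every demand vector with load $\rho$. Moreover, $\rho$ is the optimal worst-case load under centralized uncoded placement. (b) *Decentralized.* Let $0<M\le N$ and $$\rho=\frac{1-\frac MN}{\frac MN}\left[1-\left(1-\frac MN\right)^{\min(K,N)}\right].$$ If each user independently caches $\lfloor MB/N\rfloor$ uniformly random bits of each file, then for every $\delta>0$, with probability tending to $1$ as $B\to\infty$, the inner bound delivers every demand vector with load $\rho+\delta$. Moreover, $\rho$ is the optimal worst-case load under decentralized uncoded placement. -/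

import Mathlib

open Filter Topology Finset
open scoped Classical

noncomputable section

namespace CodedCaching

/-! ### Discrete entropies, in bits -/

section Entropy

variable {Ω β γ δ : Type*} [Fintype Ω] [Fintype β] [Fintype γ] [Fintype δ]

/-- Probability of the event `E` under the probability vector `w`. -/
def prob (w : Ω → ℝ) (E : Ω → Prop) : ℝ := ∑ ω with E ω, w ω

/-- Conditional entropy `H(Y | Z) = ∑ p(y,z) log₂ (p(z) / p(y,z))`; terms with
`p(y,z) = 0` contribute `0`. -/
def condEntropy (w : Ω → ℝ) (Y : Ω → β) (Z : Ω → γ) : ℝ :=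
  ∑ y, ∑ z, prob w (fun ω => Y ω = y ∧ Z ω = z) *
    Real.logb 2 (prob w (fun ω => Z ω = z) / prob w (fun ω => Y ω = y ∧ Z ω = z))

/-- Conditional mutual information `I(Y ; X | Z) = H(Y | Z) - H(Y | X, Z)`. -/
def condMutualInfo (w : Ω → ℝ) (Y : Ω → β) (X : Ω → δ) (Z : Ω → γ) : ℝ :=
  condEntropy w Y Z - condEntropy w Y (fun ω => (X ω, Z ω))

end Entropy

/-! ### The index coding inner bound based on distributed source coding -/

section IndexCoding

variable {ι κ : Type} [Fintype ι]

/-- Finite-alphabet auxiliaries: independent random variables `U i` with law `law i`, and maps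
`f P` giving the composite indices `X_P = f_P (U_i : i ∈ P)`. -/
structure Auxiliary (ι : Type) where
  size : ι → ℕ
  law : ∀ i, Fin (size i) → ℝ
  law_mem : ∀ i, law i ∈ stdSimplex ℝ (Fin (size i))
  compositeSize : Finset ι → ℕ
  f : ∀ P : Finset ι, (∀ i : {i // i ∈ P}, Fin (size i)) → Fin (compositeSize P)

namespace Auxiliary

/-- Values of the whole tuple `(U_i : i)`. -/
abbrev Outcome (a : Auxiliary ι) : Type := ∀ i, Fin (a.size i)

/-- Joint law of the independent variables `U_i`. -/
def joint (a : Auxiliary ι) (u : a.Outcome) : ℝ := ∏ i, a.law i (u i)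

/-- The tuple `(U_i : i ∈ S)`. -/
def U (a : Auxiliary ι) (S : Finset ι) (u : a.Outcome) : ∀ i : {i // i ∈ S}, Fin (a.size i) :=
  fun i => u i

/-- The tuple `(X_P : P)` of all composite indices. -/
def X (a : Auxiliary ι) (u : a.Outcome) : ∀ P : Finset ι, Fin (a.compositeSize P) :=
  fun P => a.f P (a.U P u)

end Auxiliary

/-- The inner bound for the index coding problem in which user `j` knows the messages `A j` and
demands the messages `D j`, over a noiseless channel whose alphabet has `q` letters: the rate
tuples (in bits per channel use) satisfying the conditions of the scheme for some auxiliaries. -/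
def novelRegion (A D : κ → Finset ι) (q : ℕ) : Set (ι → ℝ) :=
  {R | (∀ i, 0 ≤ R i) ∧ ∃ a : Auxiliary ι,
    (∀ j, condEntropy a.joint a.X (a.U (A j)) ≤ Real.logb 2 q) ∧
    ∀ j, ∃ T : Finset ι, D j ⊆ T ∧ Disjoint T (A j) ∧
      ∀ J ⊆ T, (D j ∩ J).Nonempty →
        ∑ i ∈ J, R i < condMutualInfo a.joint (a.U J) a.X (a.U (A j ∪ (T \ J)))}

end IndexCoding

/-! ### Caching with uncoded placement -/

section Caching

variable {K N B : ℕ}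

/-- A library of `N` files of `B` bits: bit `b` of file `i` is `F (i, b)`. -/
abbrev Library (N B : ℕ) : Type := Fin N × Fin B → Bool

/-- An uncoded placement: the set of bits of the library copied by each user. -/
abbrev Placement (K N B : ℕ) : Type := Fin K → Finset (Fin N × Fin B)

/-- The sub-file `F_{i,W}`: the bits of file `i` cached by exactly the users in `W`. -/
def subfile (C : Placement K N B) (i : Fin N) (W : Finset (Fin K)) : Finset (Fin B) :=
  {b | ∀ k, (i, b) ∈ C k ↔ k ∈ W}

/-- The messages of the index coding problem for placement `C` and demands `d`: the nonempty
sub-files of the demanded files. -/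
abbrev Message (C : Placement K N B) (d : Fin K → Fin N) : Type :=
  {p : Fin N × Finset (Fin K) // p.1 ∈ Set.range d ∧ (subfile C p.1 p.2).Nonempty}

/-- The sub-files known to user `k`. -/
def sideInfo (C : Placement K N B) (d : Fin K → Fin N) (k : Fin K) : Finset (Message C d) :=
  {p | k ∈ p.1.2}

/-- The sub-files wanted by user `k`. -/
def wanted (C : Placement K N B) (d : Fin K → Fin N) (k : Fin K) : Finset (Message C d) :=
  {p | p.1.1 = d k ∧ k ∉ p.1.2}

/-- The inner bound delivers the demands `d` with load `ρ` (transmitted bits divided by `B`):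
for each `r > ρ`, sending `r * B` bits, as `r * B / m` channel uses of `m` bits each, supports
the sub-file sizes, i.e. the rates `|F_{i,W}| / (r * B / m)` lie in the region. -/
def NovelDelivers (C : Placement K N B) (d : Fin K → Fin N) (ρ : ℝ) : Prop :=
  ∀ r > ρ, ∃ m : ℕ, 0 < m ∧
    (fun p : Message C d => ((subfile C p.1.1 p.1.2).card : ℝ) / (r * B / m)) ∈
      novelRegion (sideInfo C d) (wanted C d) (2 ^ m)

/-- The centralized placement with parameter `t`: each file is split into `K.choose t` sub-files
of equal size, one for each set `W` of `t` users, cached by exactly the users in `W`. -/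
def IsCentralizedMAN (t : ℕ) (C : Placement K N B) : Prop :=
  ∀ i W, (subfile C i W).card * K.choose t = if W.card = t then B else 0

/-- The caches holding exactly `⌊M B / N⌋` bits of each file. -/
def decentralizedMANCaches (N B : ℕ) (M : ℝ) : Finset (Finset (Fin N × Fin B)) :=
  {S | ∀ i, (S.filter fun p => p.1 = i).card = ⌊M * B / N⌋₊}

/-- The probability of the event `E` when every user, independently and uniformly at random,
chooses `⌊M B / N⌋` bits of each file to cache. -/
def decentralizedMANProb (K N B : ℕ) (M : ℝ) (E : Placement K N B → Prop) : ℝ :=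
  (((Fintype.piFinset fun _ : Fin K => decentralizedMANCaches N B M).filter E).card : ℝ) /
    (Fintype.piFinset fun _ : Fin K => decentralizedMANCaches N B M).card

/-- A delivery code of length `L` bits for given (commonly known) placement and demands. -/
structure DeliveryCode (C : Placement K N B) (L : ℕ) where
  enc : Library N B → (Fin L → Bool)
  dec : ∀ k, (Fin L → Bool) → ({p // p ∈ C k} → Bool) → (Fin B → Bool)

/-- The probability, for independent uniform file bits, that some user fails to recover its
demanded file. -/
def DeliveryCode.errorProb {C : Placement K N B} {L : ℕ} (c : DeliveryCode C L)
    (d : Fin K → Fin N) : ℝ :=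
  ((univ.filter fun F : Library N B =>
      ∃ k, c.dec k (c.enc F) (fun p => F p.1) ≠ fun b => F (d k, b)).card : ℝ) /
    Fintype.card (Library N B)

/-- The worst-case load `R` is achievable by centralized uncoded placement with caches of
`M B` bits: every demand is served by at most `R B` bits with vanishing error as `B → ∞`. -/
def CentralizedAchievable (K N : ℕ) (M R : ℝ) : Prop :=
  ∀ ε > 0, ∀ᶠ B : ℕ in atTop, ∃ C : Placement K N B,
    (∀ k, ((C k).card : ℝ) ≤ M * B) ∧
    ∀ d : Fin K → Fin N, ∃ L : ℕ, (L : ℝ) ≤ R * B ∧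
      ∃ c : DeliveryCode C L, c.errorProb d ≤ ε

/-- The worst-case load `R` is achievable by decentralized uncoded placement: the users draw
their caches independently from a common distribution `P` on sets of at most `M B` bits, and
every demand is served by at most `R B` bits with vanishing error (averaged over placement and
files) as `B → ∞`. -/
def DecentralizedAchievable (K N : ℕ) (M R : ℝ) : Prop :=
  ∀ ε > 0, ∀ᶠ B : ℕ in atTop, ∃ P ∈ stdSimplex ℝ (Finset (Fin N × Fin B)),
    (∀ S, P S ≠ 0 → (S.card : ℝ) ≤ M * B) ∧
    ∀ d : Fin K → Fin N, ∃ L : ℕ, (L : ℝ) ≤ R * B ∧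
      ∃ c : ∀ C : Placement K N B, DeliveryCode C L,
        ∑ C : Placement K N B, (∏ k, P (C k)) * (c C).errorProb d ≤ ε

/-- `(C(K,t+1) - C(K-min(K,N),t+1)) / C(K,t)`. -/
def centralizedLoad (K N t : ℕ) : ℝ :=
  ((K.choose (t + 1) : ℝ) - ((K - min K N).choose (t + 1) : ℝ)) / (K.choose t : ℝ)

/-- `((1-M/N)/(M/N)) (1 - (1-M/N)^min(K,N))`. -/
def decentralizedLoad (K N : ℕ) (M : ℝ) : ℝ :=
  (1 - M / N) / (M / N) * (1 - (1 - M / N) ^ min K N)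

end Caching

end CodedCaching

end

/-! Achievability. For a set `A` of users, the multicast sum of `A` is the XOR over `k ∈ A` of the
sub-file of `d k` cached by exactly `A \ {k}`. The sums of all sets `A` let every user decode. If
`U` contains one leader for each demanded file, the sums of the sets disjoint from `U` are linear
combinations of the others and need not be sent (`multicast_decode`). With `min K N` leaders,
`multicastCount K N w` sets of size `w + 1` remain, each costing the length of a sub-file cached by
`w` users. Such a linear code gives a point of the inner bound: take uniform independent `U_i` and
one nontrivial composite index, the codeword, so that decodability turns each mutual information
into an entropy (`mem_novelRegion_of_code`). The same code used directly on file bits gives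
operational achievability. In the decentralized case, a second-moment bound shows that all sub-files
have nearly their expected size with high probability, and the binomial theorem evaluates the load.

Converse. Order the users. The bits demanded by some user and cached neither by that user nor by an
earlier one can all be decoded in turn from the broadcast and the remaining bits, so their number
bounds the load up to one bit (`card_acyclicBits_le`). Averaging over cyclic shifts of the demands,
and over orders in the centralized case, leaves a sum over library bits. In the centralized case a
bit cached by `w` users contributes `centralizedLoad K N w`, which is convex and decreasing in `w`,
so the cache constraint and Jensen give the value at `t`. In the decentralized case the contribution
is a sum of powers of the probability that one cache avoids the bit, and the power mean inequality
concludes. -/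

noncomputable section

namespace CodedCaching

/-! ### Linear dependence among multicast sums -/

section Multicast

variable {κ φ : Type*} [DecidableEq κ]

/-- If `φ` is covered by the demands of the leaders `U` and the multicast sums of all sets meeting
`U` vanish, then the multicast sums of all sets vanish. -/
theorem multicast_eq_zero_of_surjective [Fintype φ] (d : κ → φ) (U : Finset κ)
    (hU : ∀ n, ∃ l ∈ U, d l = n) (v : φ → Finset κ → ZMod 2)
    (hY : ∀ A : Finset κ, (A ∩ U).Nonempty → ∑ k ∈ A, v (d k) (A.erase k) = 0) (A : Finset κ) :
    ∑ k ∈ A, v (d k) (A.erase k) = 0 := by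
  by_cases hA : (A ∩ U).Nonempty
  · exact hY A hA
  choose l hlU hl using hU
  set U₀ := univ.image l
  have hAU : Disjoint A U₀ := by
    rw [Finset.disjoint_left]
    intro x hx hx'
    obtain ⟨n, -, rfl⟩ := Finset.mem_image.1 hx'
    exact hA ⟨l n, Finset.mem_inter.2 ⟨hx, hlU n⟩⟩
  set G := A ∪ U₀
  let Φ : Finset (φ → κ) := Fintype.piFinset fun n => G.filter fun k => d k = n
  have hΦ : ∀ {p : φ → κ}, p ∈ Φ ↔ ∀ n, p n ∈ G ∧ d (p n) = n := by
    intro p; simp [Φ, Fintype.mem_piFinset]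
  have hlΦ : l ∈ Φ := hΦ.2 fun n => ⟨by simp [G, U₀], hl n⟩
  -- `Φ` consists of the transversals of `G`: one user of `G` demanding each file. The multicast
  -- sums of their complements in `G` add up to zero, since the terms cancel in pairs: exchanging
  -- `k` with the member of `p` that has the same demand gives the same sub-file.
  have htot : ∑ p ∈ Φ, ∑ k ∈ G \ univ.image p, v (d k) ((G \ univ.image p).erase k) = 0 := by
    rw [Finset.sum_sigma']
    have hmem : ∀ x : (_ : φ → κ) × κ, x ∈ (Φ.sigma fun p => G \ univ.image p) ↔
        (∀ n, x.1 n ∈ G ∧ d (x.1 n) = n) ∧ x.2 ∈ G ∧ ∀ n, x.1 n ≠ x.2 := by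
      intro x; simp [hΦ]
    refine Finset.sum_involution
      (fun x _ => ⟨Function.update x.1 (d x.2) x.2, x.1 (d x.2)⟩) ?_ ?_ ?_ ?_
    · rintro ⟨p, k⟩ hx
      obtain ⟨h1, h2, h3⟩ := (hmem _).1 hx
      dsimp only at h1 h2 h3 ⊢
      rw [(h1 (d k)).2]
      have : (G \ univ.image (Function.update p (d k) k)).erase (p (d k))
          = (G \ univ.image p).erase k := by
        ext y
        simp only [mem_erase, Finset.mem_sdiff, mem_image, mem_univ, true_and, not_exists]
        constructor
        · rintro ⟨h4, h5, h6⟩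
          refine ⟨fun h => h6 (d k) (by simp [h]), h5, fun n hn => ?_⟩
          by_cases hnk : n = d k
          · subst hnk; exact h4 hn.symm
          · exact h6 n (by rw [Function.update_of_ne hnk]; exact hn)
        · rintro ⟨h4, h5, h6⟩
          refine ⟨fun h => h6 _ h.symm, h5, fun n hn => ?_⟩
          by_cases hnk : n = d k
          · subst hnk; rw [Function.update_self] at hn; exact h4 hn.symm
          · rw [Function.update_of_ne hnk] at hn; exact h6 n hn
      rw [this]
      exact CharTwo.add_self_eq_zero _
    · rintro ⟨p, k⟩ hx _ heq
      obtain ⟨h1, h2, h3⟩ := (hmem _).1 hx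
      have := (Sigma.mk.inj_iff.1 heq).2
      exact h3 (d k) (eq_of_heq this)
    · rintro ⟨p, k⟩ hx
      obtain ⟨h1, h2, h3⟩ := (hmem _).1 hx
      dsimp only at h1 h2 h3
      rw [hmem]
      refine ⟨fun n => ?_, (h1 _).1, fun n hn => ?_⟩
      · dsimp only
        by_cases hnk : n = d k
        · subst hnk; rw [Function.update_self]; exact ⟨h2, rfl⟩
        · rw [Function.update_of_ne hnk]; exact h1 n
      · dsimp only at hn
        by_cases hnk : n = d k
        · subst hnk; rw [Function.update_self] at hn; exact h3 _ hn.symm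
        · rw [Function.update_of_ne hnk] at hn
          exact hnk (by rw [← (h1 n).2, hn, (h1 _).2])
    · rintro ⟨p, k⟩ hx
      obtain ⟨h1, h2, h3⟩ := (hmem _).1 hx
      dsimp only at h1 h2 h3 ⊢
      simp [(h1 (d k)).2]
  -- The transversal `l` has complement `A`. The complement of any other transversal contains a
  -- leader, so its sum vanishes by `hY`.
  rw [Finset.sum_eq_single_of_mem l hlΦ] at htot
  · have : G \ univ.image l = A := by
      simp only [G, U₀]
      rw [Finset.union_sdiff_right, Finset.sdiff_eq_self_of_disjoint hAU]
    rwa [this] at htot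
  · intro p hp hne
    obtain ⟨n, hn⟩ := Function.ne_iff.1 hne
    refine hY _ ⟨l n, ?_⟩
    have h1 := hΦ.1 hp
    simp only [mem_inter, Finset.mem_sdiff, mem_image, mem_univ, true_and, not_exists]
    refine ⟨⟨(hΦ.1 hlΦ n).1, fun m hm => hn ?_⟩, hlU n⟩
    have : m = n := by rw [← (h1 m).2, hm, hl n]
    rw [← this, hm, this]

/-- Files that nobody demands play no role, so `φ` may be replaced by the range of `d`. -/
theorem multicast_eq_zero [Finite κ] (d : κ → φ) (U : Finset κ)
    (hU : ∀ k, ∃ l ∈ U, d l = d k) (v : φ → Finset κ → ZMod 2)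
    (hY : ∀ A : Finset κ, (A ∩ U).Nonempty → ∑ k ∈ A, v (d k) (A.erase k) = 0) (A : Finset κ) :
    ∑ k ∈ A, v (d k) (A.erase k) = 0 := by
  have : Fintype (Set.range d) := Fintype.ofFinite _
  refine multicast_eq_zero_of_surjective (φ := Set.range d) (fun k => ⟨d k, k, rfl⟩) U ?_
    (fun n => v n.1) hY A
  rintro ⟨_, k, rfl⟩
  obtain ⟨l, hl, h⟩ := hU k
  exact ⟨l, hl, Subtype.ext h⟩

/-- A user that knows every sub-file it caches can decode its demanded file from the multicast
sums of the sets meeting the leaders. -/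
theorem multicast_decode [Finite κ] (d : κ → φ) (U : Finset κ)
    (hU : ∀ k, ∃ l ∈ U, d l = d k) (v : φ → Finset κ → ZMod 2) (k : κ)
    (hk : ∀ j W, k ∈ W → v (d j) W = 0)
    (hY : ∀ A : Finset κ, (A ∩ U).Nonempty → ∑ k ∈ A, v (d k) (A.erase k) = 0) (W : Finset κ) :
    v (d k) W = 0 := by
  by_cases hW : k ∈ W
  · exact hk k W hW
  have h := multicast_eq_zero d U hU v hY (insert k W)
  -- In the sum of `insert k W`, every summand except that of `k` is a sub-file cached by `k`.
  rw [Finset.sum_insert hW, Finset.erase_insert hW, Finset.sum_eq_zero, add_zero] at h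
  · exact h
  · intro j hj
    refine hk j _ (Finset.mem_erase.2 ⟨?_, Finset.mem_insert_self _ _⟩)
    rintro rfl
    exact hW hj

end Multicast

/-! ### Bounds and exact values for discrete conditional entropy -/

section Entropy

variable {Ω β γ δ : Type*} [Fintype Ω] [Fintype β] [Fintype γ] [Fintype δ] {w : Ω → ℝ}

theorem prob_nonneg (hw : w ∈ stdSimplex ℝ Ω) (E : Ω → Prop) : 0 ≤ prob w E :=
  Finset.sum_nonneg fun ω _ => hw.1 ω

theorem prob_mono (hw : w ∈ stdSimplex ℝ Ω) {E E' : Ω → Prop} (h : ∀ ω, E ω → E' ω) :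
    prob w E ≤ prob w E' :=
  Finset.sum_le_sum_of_subset_of_nonneg
    (fun ω hω => by simp only [mem_filter, mem_univ, true_and] at hω ⊢; exact h ω hω)
    fun ω _ _ => hw.1 ω

theorem sum_prob_and (Y : Ω → β) (E : Ω → Prop) :
    ∑ y, prob w (fun ω => Y ω = y ∧ E ω) = prob w E := by
  unfold prob
  rw [← Finset.sum_fiberwise (univ.filter E) Y w]
  refine Finset.sum_congr rfl fun y _ => Finset.sum_congr ?_ fun _ _ => rfl
  ext ω; simp [and_comm]

theorem sum_prob_eq_one (hw : w ∈ stdSimplex ℝ Ω) (Z : Ω → γ) :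
    ∑ z, prob w (fun ω => Z ω = z) = 1 := by
  rw [← hw.2]
  exact Finset.sum_fiberwise univ Z w

theorem sum_sum_prob_eq_one (hw : w ∈ stdSimplex ℝ Ω) (Y : Ω → β) (Z : Ω → γ) :
    ∑ y, ∑ z, prob w (fun ω => Y ω = y ∧ Z ω = z) = 1 := by
  rw [Finset.sum_comm, ← sum_prob_eq_one hw Z]
  exact Finset.sum_congr rfl fun z _ => sum_prob_and Y _

/-- A variable with at most `q` values has conditional entropy at most `log₂ q`. -/
theorem condEntropy_le_logb (hw : w ∈ stdSimplex ℝ Ω) (Y : Ω → β) (Z : Ω → γ) {q : ℕ}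
    (S : Finset β) (hS : ∀ ω, Y ω ∈ S) (hq : S.card ≤ q) (hq0 : 0 < q) :
    condEntropy w Y Z ≤ Real.logb 2 q := by
  have hl2 : 0 < Real.log 2 := Real.log_pos one_lt_two
  have hq' : (0 : ℝ) < q := by exact_mod_cast hq0
  have hout : ∀ y ∉ S, ∀ z, prob w (fun ω => Y ω = y ∧ Z ω = z) = 0 := by
    intro y hy z
    refine Finset.sum_eq_zero fun ω hω => ?_
    simp only [mem_filter, mem_univ, true_and] at hω
    exact absurd (hω.1 ▸ hS ω) hy
  have hsum1 : ∑ y ∈ S, ∑ z, prob w (fun ω => Y ω = y ∧ Z ω = z) = 1 := by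
    rw [← sum_sum_prob_eq_one hw Y Z]
    exact Finset.sum_subset (Finset.subset_univ _) fun y _ hy =>
      Finset.sum_eq_zero fun z _ => hout y hy z
  -- Gibbs' inequality termwise: `log x ≤ x - 1` at `x = p(z) / (q * p(y,z))`. The correction terms
  -- sum to at most zero because `y` ranges over at most `q` values.
  have hterm : ∀ y z, prob w (fun ω => Y ω = y ∧ Z ω = z) *
      Real.logb 2 (prob w (fun ω => Z ω = z) / prob w (fun ω => Y ω = y ∧ Z ω = z)) ≤
      prob w (fun ω => Y ω = y ∧ Z ω = z) * Real.logb 2 q +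
        (prob w (fun ω => Z ω = z) / q - prob w (fun ω => Y ω = y ∧ Z ω = z)) / Real.log 2 := by
    intro y z
    have hz := prob_nonneg hw (fun ω => Z ω = z)
    have hle : prob w (fun ω => Y ω = y ∧ Z ω = z) ≤ prob w (fun ω => Z ω = z) :=
      prob_mono hw fun ω h => h.2
    rcases (prob_nonneg hw (fun ω => Y ω = y ∧ Z ω = z)).eq_or_lt with h0 | hpos
    · rw [← h0]; simp only [zero_mul, sub_zero, zero_add]; positivity
    · generalize prob w (fun ω => Y ω = y ∧ Z ω = z) = p at *
      generalize prob w (fun ω => Z ω = z) = r at *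
      have hr : 0 < r := hpos.trans_le hle
      have h1 := Real.log_le_sub_one_of_pos (show 0 < r / (q * p) by positivity)
      rw [Real.log_div hr.ne' (by positivity), Real.log_mul hq'.ne' hpos.ne'] at h1
      rw [Real.logb, Real.logb, Real.log_div hr.ne' hpos.ne', ← mul_div_assoc, ← mul_div_assoc,
        ← add_div]
      refine div_le_div_of_nonneg_right ?_ hl2.le
      have h2 := mul_le_mul_of_nonneg_left h1 hpos.le
      have h3 : p * (r / (q * p) - 1) = r / q - p := by field_simp
      rw [h3] at h2
      linarith
  calc condEntropy w Y Z
      = ∑ y ∈ S, ∑ z, prob w (fun ω => Y ω = y ∧ Z ω = z) *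
          Real.logb 2 (prob w (fun ω => Z ω = z) / prob w (fun ω => Y ω = y ∧ Z ω = z)) := by
        refine (Finset.sum_subset (Finset.subset_univ _) fun y _ hy =>
          Finset.sum_eq_zero fun z _ => ?_).symm
        rw [hout y hy z, zero_mul]
    _ ≤ ∑ y ∈ S, ∑ z, (prob w (fun ω => Y ω = y ∧ Z ω = z) * Real.logb 2 q +
        (prob w (fun ω => Z ω = z) / q - prob w (fun ω => Y ω = y ∧ Z ω = z)) / Real.log 2) :=
        Finset.sum_le_sum fun y _ => Finset.sum_le_sum fun z _ => hterm y z
    _ = Real.logb 2 q + (S.card / q - 1) / Real.log 2 := by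
        simp only [Finset.sum_add_distrib, ← Finset.sum_mul, ← Finset.sum_div,
          Finset.sum_sub_distrib, hsum1, sum_prob_eq_one hw Z]
        simp [div_eq_mul_inv]
    _ ≤ Real.logb 2 q := by
        have : (S.card : ℝ) / q ≤ 1 := by
          rw [div_le_one hq']; exact_mod_cast hq
        have := div_nonpos_of_nonpos_of_nonneg (sub_nonpos.2 this) hl2.le
        linarith

/-- This is how zero-error decodability enters: the messages are functions of the codeword and the
side information. -/
theorem condEntropy_eq_zero (Y : Ω → β) (Z : Ω → γ)
    (h : ∀ ω ω', Z ω = Z ω' → Y ω = Y ω') : condEntropy w Y Z = 0 := by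
  refine Finset.sum_eq_zero fun y _ => Finset.sum_eq_zero fun z _ => ?_
  by_cases hω : ∃ ω, Y ω = y ∧ Z ω = z
  · obtain ⟨ω₀, rfl, rfl⟩ := hω
    have : (fun ω => Y ω = Y ω₀ ∧ Z ω = Z ω₀) = fun ω => Z ω = Z ω₀ := by
      funext ω; exact propext ⟨fun h => h.2, fun h' => ⟨h _ _ h', h'⟩⟩
    rw [this]
    by_cases h0 : prob w (fun ω => Z ω = Z ω₀) = 0
    · rw [h0, zero_mul]
    · rw [div_self h0, Real.logb_one, mul_zero]
  · have : prob w (fun ω => Y ω = y ∧ Z ω = z) = 0 := by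
      refine Finset.sum_eq_zero fun ω hw' => ?_
      simp only [mem_filter, mem_univ, true_and] at hw'
      exact absurd ⟨ω, hw'⟩ hω
    rw [this, zero_mul]

/-- If `Y` is uniform given `Z`, then `H(Y | Z)` is the logarithm of the number of values. -/
theorem condEntropy_eq_logb_card (hw : w ∈ stdSimplex ℝ Ω) (Y : Ω → β) (Z : Ω → γ)
    (h : ∀ y y' z, prob w (fun ω => Y ω = y ∧ Z ω = z) = prob w (fun ω => Y ω = y' ∧ Z ω = z)) :
    condEntropy w Y Z = Real.logb 2 (Fintype.card β) := by
  have hp : ∀ y z, prob w (fun ω => Z ω = z) =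
      Fintype.card β * prob w (fun ω => Y ω = y ∧ Z ω = z) := by
    intro y z
    rw [← sum_prob_and Y, Finset.sum_congr rfl fun y' _ => h y' y z]
    simp
  rw [← one_mul (Real.logb 2 _), ← sum_sum_prob_eq_one hw Y Z, Finset.sum_mul]
  refine Finset.sum_congr rfl fun y _ => ?_
  rw [Finset.sum_mul]
  refine Finset.sum_congr rfl fun z _ => ?_
  by_cases h0 : prob w (fun ω => Y ω = y ∧ Z ω = z) = 0
  · rw [h0, zero_mul, zero_mul]
  · rw [hp y z, mul_div_cancel_right₀ _ h0]

end Entropy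

/-! ### From zero-error index codes to the inner bound -/

section IndexCode

variable {ι κ : Type} [Fintype ι]

/-- Independent uniform variables on `c i` letters with the single composite index `g`. -/
def uniformAuxiliary (c : ι → ℕ) (hc : ∀ i, 0 < c i) {β : Type} [Fintype β]
    (g : (∀ i, Fin (c i)) → β) : Auxiliary ι where
  size := c
  law i _ := 1 / c i
  law_mem i := by
    refine ⟨fun _ => by positivity, ?_⟩
    have : (c i : ℝ) ≠ 0 := by exact_mod_cast (hc i).ne'
    simp [this]
  -- The extra letter keeps the alphabet nonempty, so that the other composite indices can be
  -- constantly `0`.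
  compositeSize _ := Fintype.card β + 1
  f P u := if P = univ then
    (Fintype.equivFin β (g fun i => if h : i ∈ P then u ⟨i, h⟩ else ⟨0, hc i⟩)).castSucc else 0

variable {c : ι → ℕ} {hc : ∀ i, 0 < c i} {β : Type} [Fintype β] {g : (∀ i, Fin (c i)) → β}

theorem uniformAuxiliary_joint_mem :
    (uniformAuxiliary c hc g).joint ∈ stdSimplex ℝ (uniformAuxiliary c hc g).Outcome := by
  refine ⟨fun u => Finset.prod_nonneg fun i _ => ((uniformAuxiliary c hc g).law_mem i).1 _, ?_⟩
  unfold Auxiliary.joint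
  have := (Finset.prod_univ_sum (fun i => (univ : Finset (Fin ((uniformAuxiliary c hc g).size i))))
    (fun i x => (uniformAuxiliary c hc g).law i x)).symm
  rw [Fintype.piFinset_univ] at this
  rw [this]
  exact Finset.prod_eq_one fun i _ => ((uniformAuxiliary c hc g).law_mem i).2

theorem uniformAuxiliary_X_eq_iff {u u' : ∀ i, Fin (c i)} :
    (uniformAuxiliary c hc g).X u = (uniformAuxiliary c hc g).X u' ↔ g u = g u' := by
  constructor
  · intro h
    have := congrFun h univ
    simpa [Auxiliary.X, uniformAuxiliary, Auxiliary.U] using this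
  · intro h
    funext P
    by_cases hP : P = univ
    · subst hP
      simp [Auxiliary.X, uniformAuxiliary, Auxiliary.U, h]
    · simp [Auxiliary.X, uniformAuxiliary, hP]

/-- The alphabet of the tuple `X` may be far larger than `q`, but `X` is a function of `g` and hence
takes no more values than `g` does. -/
theorem uniformAuxiliary_exists_finset_X {q : ℕ} (hq : (univ.image g).card ≤ q) :
    ∃ S : Finset (∀ P, Fin ((uniformAuxiliary c hc g).compositeSize P)),
      (∀ u, (uniformAuxiliary c hc g).X u ∈ S) ∧ S.card ≤ q := by
  refine ⟨(univ.image g).image fun y => if h : ∃ u, g u = y then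
    (uniformAuxiliary c hc g).X h.choose else (uniformAuxiliary c hc g).X fun i => ⟨0, hc i⟩,
    fun u => ?_, Finset.card_image_le.trans hq⟩
  have hex : ∃ u', g u' = g u := ⟨u, rfl⟩
  refine Finset.mem_image.2 ⟨g u, Finset.mem_image_of_mem _ (Finset.mem_univ _), ?_⟩
  rw [dif_pos hex]
  exact uniformAuxiliary_X_eq_iff.2 hex.choose_spec

theorem uniformAuxiliary_condEntropy_U {J S : Finset ι} (hJS : Disjoint J S) :
    condEntropy (uniformAuxiliary c hc g).joint ((uniformAuxiliary c hc g).U J)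
      ((uniformAuxiliary c hc g).U S) = ∑ i ∈ J, Real.logb 2 (c i) := by
  rw [condEntropy_eq_logb_card uniformAuxiliary_joint_mem]
  · have : Fintype.card (∀ i : {i // i ∈ J}, Fin ((uniformAuxiliary c hc g).size i)) =
        ∏ i ∈ J, c i := by
      rw [Fintype.card_pi, ← Finset.prod_coe_sort J c]
      refine Finset.prod_congr rfl fun i _ => ?_
      rw [Fintype.card_fin]; rfl
    rw [this, Nat.cast_prod, Real.logb, Real.log_prod, Finset.sum_div]
    · rfl
    · intro i _; exact_mod_cast (hc i).ne'
  · have key : ∀ y y' z, prob (uniformAuxiliary c hc g).joint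
        (fun ω => (uniformAuxiliary c hc g).U J ω = y ∧ (uniformAuxiliary c hc g).U S ω = z) ≤
        prob (uniformAuxiliary c hc g).joint
        (fun ω => (uniformAuxiliary c hc g).U J ω = y' ∧
          (uniformAuxiliary c hc g).U S ω = z) := by
      intro y y' z
      have hconst : ∀ E, prob (uniformAuxiliary c hc g).joint E =
          ((univ.filter E).card : ℝ) * ∏ i, (1 / c i : ℝ) := by
        intro E
        rw [prob, ← nsmul_eq_mul, ← Finset.sum_const]
        rfl
      rw [hconst, hconst]
      refine mul_le_mul_of_nonneg_right ?_ (Finset.prod_nonneg fun i _ => by positivity)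
      -- Overwriting the coordinates in `J` by `y'` maps one event injectively into the other,
      -- because `J` and `S` are disjoint. Exchanging `y` and `y'` gives equality.
      refine Nat.cast_le.2 (Finset.card_le_card_of_injOn
        (fun u i => if h : i ∈ J then y' ⟨i, h⟩ else u i) ?_ ?_)
      · intro u hu
        simp only [coe_filter, mem_univ, true_and, Set.mem_ofPred_eq] at hu ⊢
        obtain ⟨hy, hz⟩ := hu
        constructor
        · funext i
          simp [Auxiliary.U]
        · rw [← hz]
          funext i
          simp [Auxiliary.U, Finset.disjoint_right.1 hJS i.2]
      · intro u hu u' hu' he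
        simp only [coe_filter, mem_univ, true_and, Set.mem_ofPred_eq] at hu hu'
        funext i
        by_cases hi : i ∈ J
        · exact congrFun (hu.1.trans hu'.1.symm) ⟨i, hi⟩
        · have := congrFun he i
          simpa [hi] using this
    exact fun y y' z => le_antisymm (key y y' z) (key y' y z)

/-- A zero-error index code with at most `q` codewords for messages of `c i` letters shows that
all rates below `log₂ (c i)` lie in the inner bound. -/
theorem mem_novelRegion_of_code {A D : κ → Finset ι} (hAD : ∀ j, Disjoint (D j) (A j)) {q : ℕ}
    (c : ι → ℕ) (hc : ∀ i, 0 < c i) (g : (∀ i, Fin (c i)) → β)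
    (hq : (univ.image g).card ≤ q)
    (hdec : ∀ j u u', (∀ i ∈ A j, u i = u' i) → g u = g u' → ∀ i ∈ D j, u i = u' i)
    {R : ι → ℝ} (hR0 : ∀ i, 0 ≤ R i) (hR : ∀ i, R i < Real.logb 2 (c i)) :
    R ∈ novelRegion A D q := by
  have hq0 : 0 < q := lt_of_lt_of_le
    (Finset.card_pos.2 ⟨g fun i => ⟨0, hc i⟩, by simp⟩) hq
  -- The choice `K_j = D_j` suffices: given the side information, the codeword determines every
  -- wanted message.
  refine ⟨hR0, uniformAuxiliary c hc g, fun j => ?_, fun j => ⟨D j, subset_rfl, hAD j, ?_⟩⟩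
  · obtain ⟨S, hS, hSq⟩ := uniformAuxiliary_exists_finset_X (hc := hc) hq
    exact condEntropy_le_logb uniformAuxiliary_joint_mem _ _ S hS hSq hq0
  · intro J hJ hne
    have hdisj : Disjoint J (A j ∪ (D j \ J)) := by
      rw [Finset.disjoint_union_right]
      exact ⟨(hAD j).mono_left hJ, Finset.disjoint_sdiff⟩
    rw [condMutualInfo, uniformAuxiliary_condEntropy_U hdisj, condEntropy_eq_zero, sub_zero]
    · refine Finset.sum_lt_sum_of_nonempty ?_ fun i _ => hR i
      exact hne.mono Finset.inter_subset_right
    · intro u u' h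
      obtain ⟨hX, hU⟩ := Prod.mk_inj.1 h
      funext i
      refine hdec j u u' (fun i hi => ?_) (uniformAuxiliary_X_eq_iff.1 hX) i (hJ i.2)
      exact congrFun hU ⟨i, Finset.mem_union_left _ hi⟩

end IndexCode

/-! ### The multicast delivery scheme with leaders -/

section Delivery

variable {K N B : ℕ}

/-- The number of sets of `w + 1` users that meet a given set of `min K N` users. -/
def multicastCount (K N w : ℕ) : ℕ := K.choose (w + 1) - (K - min K N).choose (w + 1)

theorem multicastCount_cast (K N w : ℕ) : (multicastCount K N w : ℝ) =
    (K.choose (w + 1) : ℝ) - ((K - min K N).choose (w + 1) : ℝ) :=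
  Nat.cast_sub (Nat.choose_le_choose _ (Nat.sub_le _ _))

theorem exists_leaders (d : Fin K → Fin N) :
    ∃ U : Finset (Fin K), U.card = min K N ∧ ∀ k, ∃ l ∈ U, d l = d k := by
  rcases isEmpty_or_nonempty (Fin K) with hK | hK
  · have : K = 0 := (Fintype.card_fin K).symm.trans (Fintype.card_eq_zero_iff.2 hK)
    subst this
    exact ⟨∅, by simp, fun k => k.elim0⟩
  choose! l hl using fun (n : Fin N) (h : ∃ k, d k = n) => h
  have hcard : ((univ.image d).image l).card ≤ min K N := by
    refine le_min ?_ ?_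
    · exact (Finset.card_le_univ _).trans_eq (Fintype.card_fin K)
    · exact Finset.card_image_le.trans ((Finset.card_le_univ _).trans_eq (Fintype.card_fin N))
  -- Padding to exactly `min K N` leaders makes the number of transmissions the same for all
  -- demands, at its worst-case value.
  obtain ⟨U, hU, hUc⟩ := Finset.exists_superset_card_eq hcard (by simp)
  refine ⟨U, hUc, fun k => ⟨l (d k), hU ?_, hl _ ⟨k, rfl⟩⟩⟩
  exact Finset.mem_image_of_mem _ (Finset.mem_image_of_mem _ (Finset.mem_univ _))

/-- Group the sets by size and subtract those contained in the complement of `U`. -/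
theorem sum_sets_meeting (U : Finset (Fin K)) (hU : U.card = min K N) (ℓ : ℕ → ℕ) :
    ∑ A : {A : Finset (Fin K) // (A ∩ U).Nonempty}, ℓ (A.1.card - 1) =
      ∑ w ∈ range K, multicastCount K N w * ℓ w := by
  rw [Finset.sum_subtype (univ.filter fun A : Finset (Fin K) => (A ∩ U).Nonempty)
    (p := fun A => (A ∩ U).Nonempty) (fun A => by simp) (fun A => ℓ (A.card - 1)) |>.symm]
  have hpos : ∀ A : Finset (Fin K), (A ∩ U).Nonempty → 0 < A.card := fun A hA =>
    Finset.card_pos.2 (hA.mono Finset.inter_subset_left)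
  rw [← Finset.sum_fiberwise_of_maps_to (g := fun A => A.card - 1) (t := range K)]
  · refine Finset.sum_congr rfl fun w _ => ?_
    have hset : ((univ.filter fun A : Finset (Fin K) => (A ∩ U).Nonempty).filter
        fun A => A.card - 1 = w) = powersetCard (w + 1) univ \ powersetCard (w + 1) Uᶜ := by
      ext A
      simp only [mem_filter, mem_univ, true_and, Finset.mem_sdiff, mem_powersetCard, subset_univ,
        not_and]
      have hsub : A ⊆ Uᶜ ↔ ¬ (A ∩ U).Nonempty := by
        rw [Finset.subset_compl_iff_disjoint_right, Finset.not_nonempty_iff_eq_empty,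
          Finset.disjoint_iff_inter_eq_empty]
      rw [hsub]
      constructor
      · rintro ⟨h1, h2⟩
        have := hpos A h1
        exact ⟨by omega, fun h => absurd h1 h⟩
      · rintro ⟨h1, h2⟩
        exact ⟨by_contra fun h => h2 h h1, by omega⟩
    rw [Finset.sum_congr rfl (g := fun _ => ℓ w) (fun A hA => by
      rw [(Finset.mem_filter.1 hA).2]), Finset.sum_const, smul_eq_mul, hset,
      Finset.card_sdiff_of_subset (Finset.powersetCard_mono (Finset.subset_univ _)),
      Finset.card_powersetCard, Finset.card_powersetCard, Finset.card_compl, hU]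
    simp [multicastCount]
  · intro A hA
    have h1 := hpos A (Finset.mem_filter.1 hA).2
    have h2 : A.card ≤ K := (Finset.card_le_univ _).trans_eq (Fintype.card_fin K)
    simp only [Finset.mem_range]
    omega

/-- The multicast messages for all sets of users that meet the leaders `U`, when sub-files cached
by `w` users have `ℓ w` bits. -/
def multicast (d : Fin K → Fin N) (U : Finset (Fin K)) (ℓ : ℕ → ℕ)
    (u : Fin N → Finset (Fin K) → ℕ → ZMod 2)
    (A : {A : Finset (Fin K) // (A ∩ U).Nonempty}) (x : Fin (ℓ (A.1.card - 1))) : ZMod 2 :=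
  ∑ k ∈ A.1, u (d k) (A.1.erase k) x

theorem card_multicast (U : Finset (Fin K)) (hU : U.card = min K N) (ℓ : ℕ → ℕ) :
    Fintype.card (∀ A : {A : Finset (Fin K) // (A ∩ U).Nonempty},
      Fin (ℓ (A.1.card - 1)) → ZMod 2) = 2 ^ ∑ w ∈ range K, multicastCount K N w * ℓ w := by
  rw [← sum_sets_meeting U hU, Fintype.card_pi, ← Finset.prod_pow_eq_pow_sum]
  exact Finset.prod_congr rfl fun A _ => by rw [Fintype.card_fun, Fintype.card_fin, ZMod.card]

/-- By linearity, `multicast_decode` applies to the difference of `u` and `u'`, one bit position at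
a time. Sub-files are padded with zeros, so positions beyond the transmitted length carry nothing.
-/
theorem multicast_injective {d : Fin K → Fin N} {U : Finset (Fin K)}
    (hU : ∀ k, ∃ l ∈ U, d l = d k) {ℓ : ℕ → ℕ} {u u' : Fin N → Finset (Fin K) → ℕ → ZMod 2}
    (hu : ∀ i W x, ℓ W.card ≤ x → u i W x = 0) (hu' : ∀ i W x, ℓ W.card ≤ x → u' i W x = 0)
    (k : Fin K) (hk : ∀ j W, k ∈ W → u (d j) W = u' (d j) W)
    (h : multicast d U ℓ u = multicast d U ℓ u') : u (d k) = u' (d k) := by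
  funext W x
  rw [← sub_eq_zero]
  refine multicast_decode d U hU (fun i W => u i W x - u' i W x) k ?_ ?_ W
  · intro j W hW
    rw [hk j W hW, sub_self]
  · intro A hA
    rw [Finset.sum_sub_distrib, sub_eq_zero]
    by_cases hx : x < ℓ (A.card - 1)
    · exact congrFun (congrFun h ⟨A, hA⟩) ⟨x, hx⟩
    · refine Finset.sum_congr rfl fun j hj => ?_
      have : ℓ (A.erase j).card ≤ x := by rw [Finset.card_erase_of_mem hj]; omega
      rw [hu _ _ _ this, hu' _ _ _ this]

theorem sideInfo_disjoint (C : Placement K N B) (d : Fin K → Fin N) (k : Fin K) :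
    Disjoint (wanted C d k) (sideInfo C d k) := by
  rw [Finset.disjoint_left]
  intro p hp hp'
  simp only [wanted, sideInfo, mem_filter, mem_univ, true_and] at hp hp'
  exact hp.2 hp'

/-- Rates below `ℓ |W|` bits for the sub-files `F_{i,W}` are supported by a channel of `m` bits,
if `m` is at least the number of bits in the multicast messages. -/
theorem mem_novelRegion_of_multicast (C : Placement K N B) (d : Fin K → Fin N) (ℓ : ℕ → ℕ) {m : ℕ}
    (hm : ∑ w ∈ range K, multicastCount K N w * ℓ w ≤ m) {R : Message C d → ℝ}
    (hR0 : ∀ p, 0 ≤ R p) (hR : ∀ p, R p < ℓ p.1.2.card) :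
    R ∈ novelRegion (sideInfo C d) (wanted C d) (2 ^ m) := by
  obtain ⟨U, hUc, hU⟩ := exists_leaders d
  -- A letter of an alphabet of size `2 ^ ℓ` is read as `ℓ` binary digits; sub-files that are not
  -- messages count as zero.
  let bits : (∀ p : Message C d, Fin (2 ^ ℓ p.1.2.card)) → Fin N → Finset (Fin K) → ℕ → ZMod 2 :=
    fun v i W x => if h : i ∈ Set.range d ∧ (subfile C i W).Nonempty then
      if (v ⟨(i, W), h⟩).val.testBit x then 1 else 0 else 0
  have hbits : ∀ v i W x, ℓ W.card ≤ x → bits v i W x = 0 := by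
    intro v i W x hx
    simp only [bits]
    split_ifs with h h'
    · have := Nat.testBit_eq_false_of_lt
        ((v ⟨(i, W), h⟩).isLt.trans_le (Nat.pow_le_pow_right two_pos hx))
      rw [this] at h'
      exact absurd h' (by simp)
    · rfl
    · rfl
  refine mem_novelRegion_of_code (sideInfo_disjoint C d) (fun p => 2 ^ ℓ p.1.2.card)
    (fun p => by positivity) (fun v => multicast d U ℓ (bits v)) ?_ ?_ hR0 ?_
  · refine (Finset.card_le_univ _).trans ?_
    rw [card_multicast U hUc]
    exact Nat.pow_le_pow_right two_pos hm
  · intro k v v' hk hg p hp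
    simp only [wanted, mem_filter, mem_univ, true_and] at hp
    have h1 : bits v (d k) = bits v' (d k) := by
      refine multicast_injective hU (hbits v) (hbits v') k (fun j W hW => ?_) hg
      funext x
      simp only [bits]
      by_cases h : d j ∈ Set.range d ∧ (subfile C (d j) W).Nonempty
      · rw [dif_pos h, dif_pos h, hk ⟨(d j, W), h⟩ (by simp [sideInfo, hW])]
      · rw [dif_neg h, dif_neg h]
    rw [← hp.1] at h1
    refine Fin.ext (Nat.eq_of_testBit_eq fun x => ?_)
    have h2 := congrFun (congrFun h1 p.1.2) x
    simp only [bits] at h2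
    rw [dif_pos p.2, dif_pos p.2] at h2
    by_cases ha : (v p).val.testBit x <;> by_cases hb : (v' p).val.testBit x <;>
      simp_all
  · intro p
    have : Real.logb 2 ((2 ^ ℓ p.1.2.card : ℕ) : ℝ) = ℓ p.1.2.card := by
      rw [Nat.cast_pow, Nat.cast_ofNat, Real.logb_pow, Real.logb_self_eq_one one_lt_two, mul_one]
    rw [this]
    exact hR p

/-- If the sub-files cached by `w` users have at most `s w * B` bits, then the inner bound delivers
all demands with load `∑ w, multicastCount K N w * s w`. -/
theorem novelDelivers_of_card_le (C : Placement K N B) (s : ℕ → ℝ) (hs : ∀ w, 0 ≤ s w)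
    (hC : ∀ i W, ((subfile C i W).card : ℝ) ≤ s W.card * B) {ρ : ℝ}
    (hρ : ∑ w ∈ range K, (multicastCount K N w : ℝ) * s w ≤ ρ) (d : Fin K → Fin N) :
    NovelDelivers C d ρ := by
  intro r hr
  have hρ0 : 0 ≤ ρ := le_trans
    (Finset.sum_nonneg fun w _ => mul_nonneg (Nat.cast_nonneg _) (hs w)) hρ
  have hr0 : 0 < r := hρ0.trans_lt hr
  set T := ∑ w ∈ range K, (multicastCount K N w : ℝ)
  -- Rounding the sub-file lengths up costs at most one bit for each of the `T` multicast messages.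
  -- This `m` makes the slack `m * (1 - ρ / r)` exceed `T`.
  obtain ⟨m, hm⟩ := exists_nat_gt (max 0 (T * r / (r - ρ)))
  have hm0 : (0 : ℝ) < m := (le_max_left _ _).trans_lt hm
  have hmT : T * r / (r - ρ) < m := (le_max_right _ _).trans_lt hm
  refine ⟨m, by exact_mod_cast hm0, ?_⟩
  refine mem_novelRegion_of_multicast C d (fun w => ⌊s w * m / r⌋₊ + 1) ?_
    (fun p => by positivity) (fun p => ?_)
  · have h1 : ((∑ w ∈ range K, multicastCount K N w * (⌊s w * m / r⌋₊ + 1) : ℕ) : ℝ) ≤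
        ∑ w ∈ range K, (multicastCount K N w : ℝ) * s w * (m / r) + T := by
      push_cast
      rw [← Finset.sum_add_distrib]
      refine Finset.sum_le_sum fun w _ => ?_
      have := Nat.floor_le (show 0 ≤ s w * m / r from
        div_nonneg (mul_nonneg (hs w) hm0.le) hr0.le)
      have h2 := mul_le_mul_of_nonneg_left this (Nat.cast_nonneg (α := ℝ) (multicastCount K N w))
      have h3 : (multicastCount K N w : ℝ) * s w * (m / r) =
        multicastCount K N w * (s w * m / r) := by ring
      rw [h3, mul_add, mul_one]
      linarith
    rw [← Finset.sum_mul] at h1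
    have h2 : (∑ w ∈ range K, (multicastCount K N w : ℝ) * s w) * (m / r) ≤ ρ * (m / r) :=
      mul_le_mul_of_nonneg_right hρ (by positivity)
    have h3 : ρ * (m / r) + T ≤ m := by
      rw [div_lt_iff₀ (sub_pos.2 hr)] at hmT
      rw [← mul_div_assoc, div_add' _ _ _ hr0.ne', div_le_iff₀ hr0]
      linarith
    exact_mod_cast h1.trans ((add_le_add_left h2 T).trans h3)
  · have hB : 0 < B := by
      obtain ⟨b, -⟩ := p.2.2
      exact b.pos
    have hB' : (0 : ℝ) < B := by exact_mod_cast hB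
    push_cast
    refine lt_of_le_of_lt ?_ (Nat.lt_floor_add_one _)
    have := hC p.1.1 p.1.2
    rw [div_div_eq_mul_div, div_le_div_iff₀ (by positivity) hr0]
    calc _ ≤ s p.1.2.card * B * m * r := by gcongr
      _ = _ := by ring

/-- The decoder picks any library consistent with the broadcast and the cache; by `h` all of them
agree on the demanded file. -/
theorem exists_deliveryCode {C : Placement K N B} {d : Fin K → Fin N} {L : ℕ}
    (enc : Library N B → Fin L → Bool)
    (h : ∀ k F F', (∀ p ∈ C k, F p = F' p) → enc F = enc F' → ∀ b, F (d k, b) = F' (d k, b)) :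
    ∃ c : DeliveryCode C L, c.errorProb d = 0 := by
  refine ⟨⟨enc, fun k x y => if h : ∃ F : Library N B, enc F = x ∧
    (fun p : {p // p ∈ C k} => F p.1) = y then fun b => h.choose (d k, b) else fun _ => false⟩, ?_⟩
  rw [DeliveryCode.errorProb, Finset.filter_false_of_mem, Finset.card_empty, Nat.cast_zero,
    zero_div]
  rintro F - ⟨k, hk⟩
  apply hk
  have hex : ∃ F' : Library N B, enc F' = enc F ∧
    (fun p : {p // p ∈ C k} => F' p.1) = fun p => F p.1 := ⟨F, rfl, rfl⟩
  dsimp only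
  rw [dif_pos hex]
  funext b
  exact h k _ _ (fun p hp => congrFun hex.choose_spec.2 ⟨p, hp⟩) hex.choose_spec.1 b

/-- Membership in the inner bound is not itself a code; the operational loads need the multicast
scheme applied to the actual file bits. -/
theorem exists_deliveryCode_of_card_le (C : Placement K N B) (d : Fin K → Fin N) (ℓ : ℕ → ℕ)
    (hC : ∀ i W, (subfile C i W).card ≤ ℓ W.card) {L : ℕ}
    (hL : ∑ w ∈ range K, multicastCount K N w * ℓ w ≤ L) :
    ∃ c : DeliveryCode C L, c.errorProb d = 0 := by
  obtain ⟨U, hUc, hU⟩ := exists_leaders d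
  let bits : Library N B → Fin N → Finset (Fin K) → ℕ → ZMod 2 := fun F i W x =>
    if h : x < (subfile C i W).card then
      if F (i, ((subfile C i W).equivFin.symm ⟨x, h⟩).1) then 1 else 0 else 0
  have hbits : ∀ F i W x, ℓ W.card ≤ x → bits F i W x = 0 := fun F i W x hx =>
    dif_neg (not_lt.2 ((hC i W).trans hx))
  have hcard : Fintype.card (∀ A : {A : Finset (Fin K) // (A ∩ U).Nonempty},
      Fin (ℓ (A.1.card - 1)) → ZMod 2) ≤ Fintype.card (Fin L → Bool) := by
    rw [card_multicast U hUc, Fintype.card_fun, Fintype.card_bool, Fintype.card_fin]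
    exact Nat.pow_le_pow_right two_pos hL
  obtain ⟨e⟩ := Function.Embedding.nonempty_of_card_le hcard
  refine exists_deliveryCode (fun F => e (multicast d U ℓ (bits F))) ?_
  intro k F F' hk he b
  have h1 : bits F (d k) = bits F' (d k) := by
    refine multicast_injective hU (hbits F) (hbits F') k (fun j W hW => ?_) (e.injective he)
    funext x
    simp only [bits]
    by_cases h : x < (subfile C (d j) W).card
    · have hmem := (Finset.mem_filter.1 ((subfile C (d j) W).equivFin.symm ⟨x, h⟩).2).2
      rw [dif_pos h, dif_pos h, hk _ ((hmem k).2 hW)]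
    · rw [dif_neg h, dif_neg h]
  -- Each bit of the demanded file lies in exactly one sub-file, that of the set of users caching
  -- it.
  set W : Finset (Fin K) := univ.filter fun j => (d k, b) ∈ C j
  have hb : b ∈ subfile C (d k) W := by simp [subfile, W]
  have h2 := congrFun (congrFun h1 W) ((subfile C (d k) W).equivFin ⟨b, hb⟩)
  simp only [bits, Fin.is_lt, dite_true, Fin.eta, Equiv.symm_apply_apply] at h2
  by_cases ha : F (d k, b) <;> by_cases hb : F' (d k, b) <;> simp_all

end Delivery

/-! ### Achievability under centralized placement -/

section Centralized

variable {K N B : ℕ}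

theorem card_sets_of_card_containing (K t : ℕ) (k : Fin K) :
    (univ.filter fun W : {W : Finset (Fin K) // W.card = t} => k ∈ W.1).card * K =
      t * K.choose t := by
  obtain ⟨K, rfl⟩ : ∃ K', K = K' + 1 := ⟨K - 1, by have := k.pos; omega⟩
  have h1 : (univ.filter fun W : {W : Finset (Fin (K + 1)) // W.card = t} => k ∈ W.1).card =
      (powersetCard t univ \ powersetCard t {k}ᶜ : Finset (Finset (Fin (K + 1)))).card := by
    refine Finset.card_bij (fun W _ => W.1) ?_ (fun _ _ _ _ h => Subtype.ext h) ?_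
    · intro W hW
      simp only [mem_filter, mem_univ, true_and] at hW
      simp [W.2, hW]
    · intro W hW
      simp only [Finset.mem_sdiff, mem_powersetCard, subset_univ, true_and, not_and] at hW
      refine ⟨⟨W, hW.1⟩, ?_, rfl⟩
      by_contra hk
      exact hW.2 (by simpa using hk) hW.1
  rw [h1, Finset.card_sdiff_of_subset (Finset.powersetCard_mono (Finset.subset_univ _)),
    Finset.card_powersetCard, Finset.card_powersetCard, Finset.card_compl, Finset.card_univ,
    Finset.card_singleton, Fintype.card_fin, Nat.sub_mul, Nat.add_sub_cancel,
    Nat.choose_mul_succ_eq, mul_comm ((K + 1).choose t) (K + 1), mul_comm t,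
    mul_comm (K + 1) ((K + 1).choose t), ← Nat.mul_sub]
  by_cases ht : t ≤ K + 1
  · congr 1; omega
  · rw [Nat.choose_eq_zero_of_lt (by omega)]; simp

/-- The placement that splits `n * K.choose t` bits of each file evenly among the sets of `t` users
and leaves the other `r` bits uncached. -/
theorem exists_splitPlacement (K N t n r : ℕ) (hB : B = n * K.choose t + r) :
    ∃ C : Placement K N B,
      (∀ i W, (subfile C i W).card = (if W.card = t then n else 0) + if W.card = 0 then r else 0) ∧
      ∀ k, (C k).card * K = N * n * (t * K.choose t) := by
  let e : Fin B ≃ ({W : Finset (Fin K) // W.card = t} × Fin n) ⊕ Fin r :=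
    Fintype.equivOfCardEq (by simp [hB, mul_comm])
  let g : Fin B → Finset (Fin K) := fun b => Sum.elim (fun x => x.1.1) (fun _ => ∅) (e b)
  have hcount : ∀ (P : Finset (Fin K) → Prop) [DecidablePred P], (univ.filter fun b => P (g b)).card =
      n * (univ.filter fun W : {W : Finset (Fin K) // W.card = t} => P W.1).card +
        if P ∅ then r else 0 := by
    intro P _
    rw [Finset.card_filter, ← Equiv.sum_comp e.symm, Fintype.sum_sum_type, Fintype.sum_prod_type]
    simp only [g, Equiv.apply_symm_apply, Sum.elim_inl, Sum.elim_inr, Finset.sum_const,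
      Finset.card_univ, Fintype.card_fin, smul_eq_mul, Finset.card_filter, Finset.mul_sum]
    congr 1
    split_ifs <;> simp
  refine ⟨fun k => univ.filter fun p => k ∈ g p.2, fun i W => ?_, fun k => ?_⟩
  · have hs : subfile (fun k => univ.filter fun p : Fin N × Fin B => k ∈ g p.2) i W =
        univ.filter fun b => g b = W := by
      ext b; simp [subfile, Finset.ext_iff]
    rw [hs, hcount fun V => V = W]
    congr 1
    · split_ifs with hW
      · have : (univ.filter fun V : {V : Finset (Fin K) // V.card = t} => V.1 = W) = {⟨W, hW⟩} := by
          ext V; simp [Subtype.ext_iff]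
        rw [this, Finset.card_singleton, mul_one]
      · rw [Finset.filter_false_of_mem, Finset.card_empty, mul_zero]
        rintro V - rfl
        exact hW V.2
    · simp only [Finset.card_eq_zero, eq_comm]
  · have hs : (univ.filter fun p : Fin N × Fin B => k ∈ g p.2) =
        univ ×ˢ univ.filter fun b => k ∈ g b := by
      ext p; simp
    dsimp only
    rw [hs, Finset.card_product, hcount fun V => k ∈ V, Finset.card_univ, Fintype.card_fin,
      if_neg (Finset.notMem_empty k), add_zero, ← card_sets_of_card_containing K t k]
    ring

theorem centralizedLoad_eq (K N t : ℕ) :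
    centralizedLoad K N t = multicastCount K N t / K.choose t := by
  rw [centralizedLoad, multicastCount_cast]

theorem card_le_of_card_mul_eq {t n c : ℕ} (hK : 0 < K) (hc : c * K = N * n * (t * K.choose t))
    (hn : n * K.choose t ≤ B) : (c : ℝ) ≤ (t * N / K : ℝ) * B := by
  have hK' : (0 : ℝ) < K := by exact_mod_cast hK
  rw [div_mul_eq_mul_div, le_div_iff₀ hK']
  have h1 : c * K ≤ t * N * B := by
    rw [hc]
    calc _ = t * N * (n * K.choose t) := by ring
      _ ≤ _ := Nat.mul_le_mul_left _ hn
  exact_mod_cast h1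

theorem exists_centralizedMAN (hK : 0 < K) {t : ℕ} (ht : t ≤ K) (hB : K.choose t ∣ B) :
    ∃ C : Placement K N B, IsCentralizedMAN t C ∧
      (∀ k, ((C k).card : ℝ) ≤ (t * N / K : ℝ) * B) ∧
      ∀ d : Fin K → Fin N, NovelDelivers C d (centralizedLoad K N t) := by
  obtain ⟨n, rfl⟩ := hB
  obtain ⟨C, hC, hCk⟩ := exists_splitPlacement (B := K.choose t * n) K N t n 0 (by ring)
  have hpos : (0 : ℝ) < K.choose t := by exact_mod_cast Nat.choose_pos ht
  simp only [ite_self, add_zero] at hC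
  refine ⟨C, fun i W => ?_, fun k => card_le_of_card_mul_eq hK (hCk k) (by rw [mul_comm]), ?_⟩
  · rw [hC]; split_ifs <;> ring
  · refine novelDelivers_of_card_le C (fun w => if w = t then 1 / (K.choose t : ℝ) else 0)
      (fun w => by split_ifs <;> positivity) (fun i W => ?_) ?_
    · rw [hC]
      split_ifs
      · push_cast; field_simp; exact le_rfl
      · simp
    · rw [centralizedLoad_eq]
      simp only [mul_ite, mul_zero, Finset.sum_ite_eq', mul_one_div]
      -- For `t = K` the index lies outside the range: everything is cached and nothing is sent.
      split_ifs
      · exact le_rfl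
      · positivity

theorem centralizedAchievable_of_lt (hK : 0 < K) {t : ℕ} (ht : t ≤ K) {R : ℝ}
    (hR : centralizedLoad K N t < R) : CentralizedAchievable K N (t * N / K : ℝ) R := by
  intro ε hε
  have hpos' := Nat.choose_pos ht
  have hpos : (0 : ℝ) < K.choose t := by exact_mod_cast hpos'
  -- When `K.choose t` does not divide `B`, fewer than `K.choose t` bits of each file stay uncached.
  -- Sending them takes a number of bits bounded independently of `B`, which the slack in `R`
  -- absorbs.
  have hlarge := (tendsto_natCast_atTop_atTop (R := ℝ)).eventually_ge_atTop
    ((multicastCount K N 0 * K.choose t : ℝ) / (R - centralizedLoad K N t))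
  filter_upwards [hlarge] with B hB
  obtain ⟨C, hC, hCk⟩ := exists_splitPlacement (B := B) K N t (B / K.choose t) (B % K.choose t)
    (Nat.div_add_mod' B _).symm
  refine ⟨C, fun k => card_le_of_card_mul_eq hK (hCk k) (Nat.div_mul_le_self _ _), fun d =>
    ⟨multicastCount K N t * (B / K.choose t) + multicastCount K N 0 * (B % K.choose t), ?_, ?_⟩⟩
  · rw [div_le_iff₀ (sub_pos.2 hR)] at hB
    have h1 : ((B / K.choose t : ℕ) : ℝ) ≤ B / K.choose t := Nat.cast_div_le
    have h2 : ((B % K.choose t : ℕ) : ℝ) ≤ K.choose t := by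
      exact_mod_cast (Nat.mod_lt _ hpos').le
    have h3 := mul_le_mul_of_nonneg_left h1 (Nat.cast_nonneg (α := ℝ) (multicastCount K N t))
    have h4 := mul_le_mul_of_nonneg_left h2 (Nat.cast_nonneg (α := ℝ) (multicastCount K N 0))
    have h5 : (multicastCount K N t : ℝ) * (B / K.choose t) = centralizedLoad K N t * B := by
      rw [centralizedLoad_eq]; ring
    push_cast
    linarith
  · obtain ⟨c, hc⟩ := exists_deliveryCode_of_card_le C d
      (fun w => (if w = t then B / K.choose t else 0) + if w = 0 then B % K.choose t else 0)
      (fun i W => (hC i W).le)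
      (L := multicastCount K N t * (B / K.choose t) + multicastCount K N 0 * (B % K.choose t)) (by
        simp only [mul_add, mul_ite, mul_zero, Finset.sum_add_distrib, Finset.sum_ite_eq']
        gcongr <;> split_ifs <;> simp)
    exact ⟨c, by rw [hc]; exact hε.le⟩

end Centralized

/-! ### Converse under centralized placement -/

section Converse

variable {K N B : ℕ}

/-- For users `σ 0, σ 1, …`, the bits demanded by some `σ j` and cached by none of
`σ 0, …, σ j`. -/
def acyclicBits {s : ℕ} (C : Placement K N B) (d : Fin K → Fin N) (σ : Fin s → Fin K) :
    Finset (Fin N × Fin B) :=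
  univ.biUnion fun j => univ.filter fun p => p.1 = d (σ j) ∧ ∀ i ≤ j, p ∉ C (σ i)

theorem mem_acyclicBits {s : ℕ} {C : Placement K N B} {d : Fin K → Fin N} {σ : Fin s → Fin K}
    {p : Fin N × Fin B} :
    p ∈ acyclicBits C d σ ↔ ∃ j, p.1 = d (σ j) ∧ ∀ i ≤ j, p ∉ C (σ i) := by
  simp [acyclicBits]

/-- A delivery code that fails with probability at most one half has at least as many bits, up to
one, as any set of acyclic bits. -/
theorem card_acyclicBits_le {C : Placement K N B} {L s : ℕ} (c : DeliveryCode C L)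
    {d : Fin K → Fin N} (hc : c.errorProb d ≤ 1 / 2) (σ : Fin s → Fin K) :
    (acyclicBits C d σ).card ≤ L + 1 := by
  set S := acyclicBits C d σ
  set bad := univ.filter fun F : Library N B =>
    ∃ k, c.dec k (c.enc F) (fun p => F p.1) ≠ fun b => F (d k, b)
  have hgood : ∀ F ∈ badᶜ, ∀ k, c.dec k (c.enc F) (fun p => F p.1) = fun b => F (d k, b) := by
    intro F hF
    simpa [bad] using hF
  -- On libraries decoded correctly, the codeword and the bits outside `S` determine everything:
  -- users decode in the order `σ`.
  have hinj : Set.InjOn (fun F : Library N B =>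
      (c.enc F, fun p : {p // p ∈ Sᶜ} => F p.1)) (badᶜ : Finset (Library N B)) := by
    intro F hF F' hF' h
    obtain ⟨he, ho⟩ := Prod.mk_inj.1 h
    have hout : ∀ p ∉ S, F p = F' p := fun p hp => congrFun ho ⟨p, Finset.mem_compl.2 hp⟩
    have hfile : ∀ n (hn : n < s), ∀ b, F (d (σ ⟨n, hn⟩), b) = F' (d (σ ⟨n, hn⟩), b) := by
      intro n
      induction n using Nat.strong_induction_on with
      | _ n ih =>
        intro hn b
        have hcache : (fun p : {p // p ∈ C (σ ⟨n, hn⟩)} => F p.1) = fun p => F' p.1 := by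
          funext ⟨p, hp⟩
          -- A bit of `S` in the cache of user `σ n` must be demanded by an earlier user, hence is
          -- already decoded.
          by_cases hpS : p ∈ S
          · obtain ⟨j, hj, hj'⟩ := mem_acyclicBits.1 hpS
            have hlt : j.1 < n := by
              by_contra hle
              exact hj' ⟨n, hn⟩ (Fin.mk_le_of_le_val (not_lt.1 hle)) hp
            have := ih j.1 hlt j.2 p.2
            rwa [Fin.eta, ← hj] at this
          · exact hout p hpS
        have h1 := hgood F hF (σ ⟨n, hn⟩)
        rw [he, hcache, hgood F' hF' (σ ⟨n, hn⟩)] at h1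
        exact (congrFun h1 b).symm
    funext p
    by_cases hpS : p ∈ S
    · obtain ⟨j, hj, -⟩ := mem_acyclicBits.1 hpS
      have := hfile j.1 j.2 p.2
      rwa [Fin.eta, ← hj] at this
    · exact hout p hpS
  have hcard : badᶜ.card ≤ 2 ^ L * 2 ^ (N * B - S.card) := by
    refine (Finset.card_le_card_of_injOn _ (fun _ _ => Finset.mem_coe.2 (Finset.mem_univ _))
      hinj).trans_eq ?_
    simp
  have hlib : Fintype.card (Library N B) = 2 ^ (N * B) := by simp
  have hS : S.card ≤ N * B := (Finset.card_le_univ _).trans_eq (by simp)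
  have hbad : 2 * bad.card ≤ 2 ^ (N * B) := by
    rw [DeliveryCode.errorProb, div_le_iff₀ (by rw [hlib]; positivity), hlib] at hc
    have : (2 * bad.card : ℝ) ≤ ((2 ^ (N * B) : ℕ) : ℝ) := by
      change (bad.card : ℝ) ≤ _ at hc
      linarith
    exact_mod_cast this
  rw [Finset.card_compl, hlib] at hcard
  -- At least half of the libraries are good; this factor of two is the extra bit in the bound.
  have h2 : 2 ^ (N * B) ≤ 2 ^ (L + 1 + (N * B - S.card)) := by
    rw [pow_add, pow_succ, mul_right_comm]
    omega
  have := (Nat.pow_le_pow_iff_right one_lt_two).1 h2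
  omega

/-- Demands that are cyclically shifted by `a`. -/
def shiftedDemands [NeZero N] (σ : Equiv.Perm (Fin K)) (a : Fin N) (k : Fin K) : Fin N :=
  Fin.ofNat N (σ.symm k).val + a

/-- The first `min K N` users in the order `σ`. -/
def firstUsers (N : ℕ) (σ : Equiv.Perm (Fin K)) (j : Fin (min K N)) : Fin K :=
  σ (Fin.castLE (min_le_left _ _) j)

/-- The first `min K N` users have distinct demands, so the union is disjoint. As `a` varies, each
of them demands every file exactly once. -/
theorem sum_card_acyclicBits [NeZero N] (C : Placement K N B) (σ : Equiv.Perm (Fin K)) :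
    ∑ a, (acyclicBits C (shiftedDemands σ a) (firstUsers N σ)).card =
      ∑ j, (univ.filter fun p => ∀ i ≤ j, p ∉ C (firstUsers N σ i)).card := by
  have hd : ∀ a j, shiftedDemands σ a (firstUsers N σ j) =
      Fin.castLE (min_le_right K N) j + a := by
    intro a j
    simp only [shiftedDemands, firstUsers, Equiv.symm_apply_apply, Fin.val_castLE]
    congr 1
    ext
    exact Nat.mod_eq_of_lt (j.2.trans_le (min_le_right _ _))
  have h1 : ∀ a, (acyclicBits C (shiftedDemands σ a) (firstUsers N σ)).card =
      ∑ j, (univ.filter fun p : Fin N × Fin B => p.1 = Fin.castLE (min_le_right K N) j + a ∧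
        ∀ i ≤ j, p ∉ C (firstUsers N σ i)).card := by
    intro a
    rw [acyclicBits, Finset.card_biUnion]
    · simp only [hd]
    · intro j _ j' _ hne
      rw [Function.onFun_apply, Finset.disjoint_left]
      intro p hp hp'
      simp only [mem_filter, mem_univ, true_and, hd] at hp hp'
      have := add_right_cancel (hp.1.symm.trans hp'.1)
      exact hne (Fin.castLE_injective _ this)
  rw [Finset.sum_congr rfl fun a _ => h1 a, Finset.sum_comm]
  refine Finset.sum_congr rfl fun j _ => ?_
  rw [← Finset.card_biUnion]
  · congr 1
    ext p
    simp only [mem_biUnion, mem_filter, mem_univ, true_and]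
    exact ⟨fun ⟨_, h⟩ => h.2, fun h => ⟨p.1 - Fin.castLE (min_le_right K N) j, by simp, h⟩⟩
  · intro a _ a' _ hne
    rw [Function.onFun_apply, Finset.disjoint_left]
    intro p hp hp'
    simp only [mem_filter, mem_univ, true_and] at hp hp'
    exact hne (add_left_cancel (hp.1.symm.trans hp'.1))

/-- The count depends only on the size of `W`, by composing with a permutation that carries one set
to another. It is therefore found by averaging over all sets of that size: each `σ` avoids those in
the complement of `σ(A)`. -/
theorem card_perm_avoiding (A W : Finset (Fin K)) :
    (univ.filter fun σ : Equiv.Perm (Fin K) => ∀ i ∈ A, σ i ∉ W).card * K.choose W.card =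
      K.factorial * (K - A.card).choose W.card := by
  have hsym : ∀ V : Finset (Fin K), V.card = W.card →
      (univ.filter fun σ : Equiv.Perm (Fin K) => ∀ i ∈ A, σ i ∉ V).card =
      (univ.filter fun σ : Equiv.Perm (Fin K) => ∀ i ∈ A, σ i ∉ W).card := by
    intro V hV
    let e : {x // x ∈ V} ≃ {x // x ∈ W} := Finset.equivOfCardEq hV
    have hmem : ∀ x, e.extendSubtype x ∈ W ↔ x ∈ V := fun x =>
      ⟨fun h => by_contra fun h' => e.extendSubtype_not_mem x h' h, e.extendSubtype_mem x⟩
    refine Finset.card_equiv (Equiv.mulLeft e.extendSubtype) fun σ => ?_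
    simp [hmem]
  have hsum : ∑ V ∈ powersetCard W.card (univ : Finset (Fin K)),
      (univ.filter fun σ : Equiv.Perm (Fin K) => ∀ i ∈ A, σ i ∉ V).card =
      K.factorial * (K - A.card).choose W.card := by
    simp only [Finset.card_filter]
    rw [Finset.sum_comm]
    have : ∀ σ : Equiv.Perm (Fin K), ∑ V ∈ powersetCard W.card (univ : Finset (Fin K)),
        (if ∀ i ∈ A, σ i ∉ V then 1 else 0) = (K - A.card).choose W.card := by
      intro σ
      rw [← Finset.card_filter]
      have hs : ((powersetCard W.card (univ : Finset (Fin K))).filter fun V => ∀ i ∈ A, σ i ∉ V) =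
          powersetCard W.card (A.map σ.toEmbedding)ᶜ := by
        ext V
        simp only [mem_filter, mem_powersetCard, subset_univ, true_and,
          Finset.subset_compl_iff_disjoint_left]
        rw [and_comm, Finset.disjoint_left]
        refine and_congr_left fun _ => ⟨fun h a ha hV => ?_, fun h i hi => h (by simpa using hi)⟩
        obtain ⟨i, hi, rfl⟩ := Finset.mem_map.1 ha
        exact h i hi hV
      rw [hs, Finset.card_powersetCard, Finset.card_compl, Finset.card_map, Fintype.card_fin]
    rw [Finset.sum_congr rfl fun σ _ => this σ, Finset.sum_const, Finset.card_univ,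
      Fintype.card_perm, Fintype.card_fin, smul_eq_mul]
  rw [← hsum, Finset.sum_congr rfl fun V hV => hsym V (Finset.mem_powersetCard.1 hV).2,
    Finset.sum_const, Finset.card_powersetCard, Finset.card_univ, Fintype.card_fin, smul_eq_mul,
    mul_comm]

theorem choose_mul_choose_sub (K w j : ℕ) :
    K.choose w * (K - w).choose j = K.choose j * (K - j).choose w := by
  have h1 := Nat.choose_mul (n := K) (Nat.le_add_right w j)
  have h2 := Nat.choose_mul (n := K) (Nat.le_add_left j w)
  rw [Nat.add_sub_cancel_left] at h1
  rw [Nat.add_sub_cancel] at h2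
  rw [← h1, ← h2, Nat.choose_symm_add]

/-- Discrete convexity: the increments `n.choose i` of `n.choose (i + 1)` are nondecreasing in `n`.
-/
theorem choose_succ_supporting_line (n m i : ℕ) :
    (m.choose (i + 1) : ℝ) + m.choose i * ((n : ℝ) - m) ≤ n.choose (i + 1) := by
  rcases le_total m n with h | h
  · induction n, h using Nat.le_induction with
    | base => simp
    | succ n hmn ih =>
      have : (m.choose i : ℝ) ≤ n.choose i := by exact_mod_cast Nat.choose_le_choose i hmn
      rw [Nat.choose_succ_succ' n i]
      push_cast
      linarith
  · induction m, h using Nat.le_induction with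
    | base => simp
    | succ m hnm ih =>
      have h1 : (m.choose i : ℝ) ≤ (m + 1).choose i := by
        exact_mod_cast Nat.choose_le_choose i m.le_succ
      have h2 : (n : ℝ) ≤ m := by exact_mod_cast hnm
      have h3 := mul_le_mul_of_nonpos_right h1 (show (n : ℝ) - m - 1 ≤ 0 by linarith)
      rw [Nat.choose_succ_succ' m i]
      push_cast
      linarith

theorem sum_choose_sub (K w s : ℕ) (hs : s ≤ K) :
    ∑ j ∈ range s, (K - (j + 1)).choose w + (K - s).choose (w + 1) = K.choose (w + 1) := by
  induction s with
  | zero => simp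
  | succ s ih =>
    rw [Finset.sum_range_succ, add_assoc, ← Nat.choose_succ_succ', ← ih (by omega)]
    congr 2
    omega

theorem sum_choose_sub_eq (K N w : ℕ) :
    (∑ j ∈ range (min K N), (K - (j + 1)).choose w : ℝ) =
      (K.choose (w + 1) : ℝ) - ((K - min K N).choose (w + 1) : ℝ) := by
  rw [← sum_choose_sub K w (min K N) (min_le_left _ _)]
  push_cast
  ring

/-- In this form the variable `w` occurs only in the upper index of a binomial coefficient, so
convexity in `w` is visible termwise. -/
theorem centralizedLoad_eq_sum {w : ℕ} (hw : w ≤ K) : centralizedLoad K N w =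
    ∑ j ∈ range (min K N), ((K - w).choose (j + 1) : ℝ) / K.choose (j + 1) := by
  rw [centralizedLoad, ← sum_choose_sub_eq, Finset.sum_div]
  refine Finset.sum_congr rfl fun j hj => ?_
  have hj' : j + 1 ≤ K := (Finset.mem_range.1 hj).trans_le (min_le_left _ _)
  have h1 : (K.choose w : ℝ) ≠ 0 := by exact_mod_cast (Nat.choose_pos hw).ne'
  have h2 : (K.choose (j + 1) : ℝ) ≠ 0 := by exact_mod_cast (Nat.choose_pos hj').ne'
  rw [div_eq_div_iff h1 h2]
  have := choose_mul_choose_sub K w (j + 1)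
  rw [mul_comm, mul_comm _ (K.choose w : ℝ)]
  exact_mod_cast this.symm

/-- The line carries out Jensen's inequality. Its sign condition `0 ≤ c` is needed because the cache
constraint bounds the average of `w` only from above. -/
theorem exists_centralizedLoad_supporting_line {t : ℕ} (ht : t ≤ K) : ∃ c : ℝ, 0 ≤ c ∧
    ∀ w ≤ K, centralizedLoad K N t + c * ((t : ℝ) - w) ≤ centralizedLoad K N w := by
  refine ⟨∑ j ∈ range (min K N), ((K - t).choose j : ℝ) / K.choose (j + 1),
    Finset.sum_nonneg fun _ _ => by positivity, fun w hw => ?_⟩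
  rw [centralizedLoad_eq_sum ht, centralizedLoad_eq_sum hw, Finset.sum_mul,
    ← Finset.sum_add_distrib]
  refine Finset.sum_le_sum fun j _ => ?_
  rw [div_mul_eq_mul_div, ← add_div]
  refine div_le_div_of_nonneg_right ?_ (Nat.cast_nonneg _)
  have := choose_succ_supporting_line (K - w) (K - t) j
  rwa [Nat.cast_sub hw, Nat.cast_sub ht, sub_sub_sub_cancel_left] at this

/-- In a random order, a bit cached by `w` users is missed by the first `j + 1` users with
probability `(K - (j + 1)).choose w / K.choose w`; these add up to the load at `w`. -/
theorem sum_perm_card_avoiding (C : Placement K N B) :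
    (∑ σ : Equiv.Perm (Fin K), ∑ j,
      (univ.filter fun p => ∀ i ≤ j, p ∉ C (firstUsers N σ i)).card : ℝ) =
      K.factorial * ∑ p, centralizedLoad K N (univ.filter fun k => p ∈ C k).card := by
  have hcount : ∀ (σ : Equiv.Perm (Fin K)) j,
      ((univ.filter fun p => ∀ i ≤ j, p ∉ C (firstUsers N σ i)).card : ℝ) =
        ∑ p, if ∀ i ≤ j, p ∉ C (firstUsers N σ i) then 1 else 0 := by
    intro σ j
    rw [Finset.card_filter]
    push_cast
    rfl
  simp only [hcount]
  rw [Finset.mul_sum]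
  trans ∑ σ : Equiv.Perm (Fin K), ∑ p, ∑ j,
    if ∀ i ≤ j, p ∉ C (firstUsers N σ i) then (1 : ℝ) else 0
  · exact Finset.sum_congr rfl fun σ _ => Finset.sum_comm
  rw [Finset.sum_comm]
  refine Finset.sum_congr rfl fun p _ => ?_
  rw [Finset.sum_comm]
  set W := univ.filter fun k => p ∈ C k
  have hW : W.card ≤ K := (Finset.card_le_univ _).trans_eq (Fintype.card_fin K)
  have hpos : (K.choose W.card : ℝ) ≠ 0 := by exact_mod_cast (Nat.choose_pos hW).ne'
  rw [centralizedLoad, ← sum_choose_sub_eq, Finset.sum_div, Finset.mul_sum,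
    ← Fin.sum_univ_eq_sum_range
      (fun j => (K.factorial : ℝ) * (((K - (j + 1)).choose W.card : ℝ) / K.choose W.card))]
  refine Finset.sum_congr rfl fun j _ => ?_
  rw [← mul_div_assoc, eq_div_iff hpos]
  set A : Finset (Fin K) := univ.filter fun i => i.val ≤ j.val
  have hA : A.card = j + 1 := by
    have hj : j.val < K := j.2.trans_le (min_le_left _ _)
    have : A = Finset.Iic ⟨j.val, hj⟩ := by ext i; simp [A, Fin.le_def]
    rw [this, Fin.card_Iic]
  have h1 := card_perm_avoiding A W
  rw [hA] at h1
  rw [← Nat.cast_mul, ← h1, Nat.cast_mul, Finset.sum_boole]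
  congr 3
  ext σ
  simp only [mem_filter, mem_univ, true_and]
  refine ⟨fun h i hi => ?_, fun h i hi => ?_⟩
  · simp only [A, mem_filter, mem_univ, true_and] at hi
    have := h ⟨i, hi.trans_lt j.2⟩ hi
    simpa [W, firstUsers] using this
  · have := h (Fin.castLE (min_le_left _ _) i) (by simpa [A] using hi)
    simpa [W, firstUsers] using this

theorem centralizedLoad_le_of_achievable (hK : 0 < K) (hN : 0 < N) {t : ℕ} (ht : t ≤ K) {R : ℝ}
    (hR : CentralizedAchievable K N (t * N / K : ℝ) R) : centralizedLoad K N t ≤ R := by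
  have : NeZero N := ⟨hN.ne'⟩
  have hN' : (0 : ℝ) < N := by exact_mod_cast hN
  have hK' : (0 : ℝ) < K := by exact_mod_cast hK
  by_contra! hlt
  have hev := hR (1 / 2) (by norm_num)
  have hlarge := (tendsto_natCast_atTop_atTop (R := ℝ)).eventually_gt_atTop
    (1 / (centralizedLoad K N t - R))
  obtain ⟨B, ⟨C, hC, hd⟩, hB⟩ := (hev.and hlarge).exists
  rw [div_lt_iff₀ (sub_pos.2 hlt)] at hB
  have hS : ∀ (σ : Equiv.Perm (Fin K)) (a : Fin N),
      ((acyclicBits C (shiftedDemands σ a) (firstUsers N σ)).card : ℝ) ≤ R * B + 1 := by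
    intro σ a
    obtain ⟨L, hL, c, hc⟩ := hd (shiftedDemands σ a)
    have : ((acyclicBits C (shiftedDemands σ a) (firstUsers N σ)).card : ℝ) ≤ L + 1 := by
      exact_mod_cast card_acyclicBits_le c hc (firstUsers N σ)
    linarith
  have h1 : (∑ σ : Equiv.Perm (Fin K), ∑ a,
      ((acyclicBits C (shiftedDemands σ a) (firstUsers N σ)).card : ℝ)) ≤
      ∑ σ : Equiv.Perm (Fin K), ∑ a : Fin N, (R * B + 1) :=
    Finset.sum_le_sum fun σ _ => Finset.sum_le_sum fun a _ => hS σ a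
  have h2 : (∑ σ : Equiv.Perm (Fin K), ∑ a,
      ((acyclicBits C (shiftedDemands σ a) (firstUsers N σ)).card : ℝ)) =
      K.factorial * ∑ p, centralizedLoad K N (univ.filter fun k => p ∈ C k).card := by
    rw [← sum_perm_card_avoiding]
    refine Finset.sum_congr rfl fun σ _ => ?_
    exact_mod_cast sum_card_acyclicBits C σ
  rw [h2] at h1
  simp only [Finset.sum_const, Finset.card_univ, Fintype.card_perm, Fintype.card_fin,
    nsmul_eq_mul] at h1
  have h3 := le_of_mul_le_mul_left h1 (by exact_mod_cast K.factorial_pos)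
  obtain ⟨c, hc0, hc⟩ := exists_centralizedLoad_supporting_line (N := N) ht
  have h4 : ∑ p : Fin N × Fin B, (centralizedLoad K N t +
      c * ((t : ℝ) - (univ.filter fun k => p ∈ C k).card)) ≤ N * (R * B + 1) :=
    (Finset.sum_le_sum fun p _ =>
      hc _ ((Finset.card_le_univ _).trans_eq (Fintype.card_fin K))).trans h3
  -- Counting pairs of a user and a cached bit bounds the total multiplicity by the total cache
  -- size.
  have h5 : ∑ p, ((univ.filter fun k => p ∈ C k).card : ℝ) ≤ t * N * B := by
    have : ∑ p, (univ.filter fun k => p ∈ C k).card = ∑ k, (C k).card := by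
      simp only [Finset.card_filter]
      rw [Finset.sum_comm]
      exact Finset.sum_congr rfl fun k _ => by simp
    calc ∑ p, ((univ.filter fun k => p ∈ C k).card : ℝ) = ∑ k, ((C k).card : ℝ) := by
          exact_mod_cast this
      _ ≤ ∑ k : Fin K, (t * N / K : ℝ) * B := Finset.sum_le_sum fun k _ => hC k
      _ = t * N * B := by simp; field_simp
  rw [Finset.sum_add_distrib, ← Finset.mul_sum, Finset.sum_sub_distrib] at h4
  simp only [Finset.sum_const, Finset.card_univ, Fintype.card_prod, Fintype.card_fin,
    nsmul_eq_mul, Nat.cast_mul] at h4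
  have h6 : 0 ≤ c * ((N : ℝ) * B * t - ∑ p, ((univ.filter fun k => p ∈ C k).card : ℝ)) :=
    mul_nonneg hc0 (by linarith)
  have h7 : (N : ℝ) * (B * centralizedLoad K N t) ≤ N * (R * B + 1) := by linarith
  have h8 := le_of_mul_le_mul_left h7 hN'
  linarith

end Converse

/-! ### Converse under decentralized placement -/

section DecentralizedConverse

variable {K N B : ℕ}

theorem sum_placement_prod (P : Finset (Fin N × Fin B) → ℝ)
    (f : Fin K → Finset (Fin N × Fin B) → ℝ) :
    ∑ C : Placement K N B, (∏ k, P (C k)) * ∏ k, f k (C k) = ∏ k, ∑ S, P S * f k S := by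
  simp only [← Finset.prod_mul_distrib]
  rw [Finset.prod_univ_sum, Fintype.piFinset_univ]

theorem sum_placement_eq_one {P : Finset (Fin N × Fin B) → ℝ}
    (hP : P ∈ stdSimplex ℝ (Finset (Fin N × Fin B))) :
    ∑ C : Placement K N B, ∏ k, P (C k) = 1 := by
  have h := sum_placement_prod (K := K) P fun _ _ => 1
  simpa [hP.2] using h

/-- Probability that a cache drawn from `P` avoids the bit `p`. -/
def avoidProb (P : Finset (Fin N × Fin B) → ℝ) (p : Fin N × Fin B) : ℝ :=
  ∑ S, P S * if p ∉ S then 1 else 0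

theorem sum_prod_avoiding {P : Finset (Fin N × Fin B) → ℝ}
    (hP : P ∈ stdSimplex ℝ (Finset (Fin N × Fin B))) (p : Fin N × Fin B) (j : Fin (min K N)) :
    ∑ C : Placement K N B, (∏ k, P (C k)) *
      (if ∀ i ≤ j, p ∉ C (firstUsers N 1 i) then 1 else 0) = avoidProb P p ^ (j.val + 1) := by
  have hj : j.val < K := j.2.trans_le (min_le_left _ _)
  have h1 : ∀ C : Placement K N B, (if ∀ i ≤ j, p ∉ C (firstUsers N 1 i) then (1 : ℝ) else 0) =
      ∏ k, if k.val ≤ j.val then (if p ∉ C k then 1 else 0) else 1 := by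
    intro C
    have : (∀ i ≤ j, p ∉ C (firstUsers N 1 i)) ↔ ∀ k : Fin K, k.val ≤ j.val → p ∉ C k :=
      ⟨fun h k hk => h ⟨k.val, hk.trans_lt j.2⟩ hk, fun h i hi => h _ hi⟩
    simp only [this]
    split_ifs with h
    · exact (Finset.prod_eq_one fun k _ => by
        by_cases hk : k.val ≤ j.val
        · rw [if_pos hk, if_pos (h k hk)]
        · rw [if_neg hk]).symm
    · push Not at h
      obtain ⟨k, hk, hp⟩ := h
      exact (Finset.prod_eq_zero (Finset.mem_univ k) (by
        rw [if_pos hk, if_neg (not_not.2 hp)])).symm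
  rw [Finset.sum_congr rfl fun C _ => by rw [h1 C], sum_placement_prod P fun k S =>
    if k.val ≤ j.val then (if p ∉ S then (1 : ℝ) else 0) else 1]
  have h3 : ∀ k : Fin K, ∑ S, P S * (if k.val ≤ j.val then (if p ∉ S then (1 : ℝ) else 0) else 1) =
      if k.val ≤ j.val then avoidProb P p else 1 := by
    intro k
    split_ifs
    · rfl
    · simpa using hP.2
  rw [Finset.prod_congr rfl fun k _ => h3 k, Finset.prod_ite, Finset.prod_const_one, mul_one,
    Finset.prod_const]
  congr 1
  have : (univ.filter fun k : Fin K => k.val ≤ j.val) = Finset.Iic ⟨j.val, hj⟩ := by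
    ext i; simp [Fin.le_def]
  rw [this, Fin.card_Iic]

theorem le_sum_avoidProb {P : Finset (Fin N × Fin B) → ℝ}
    (hP : P ∈ stdSimplex ℝ (Finset (Fin N × Fin B))) {m : ℝ}
    (hm : ∀ S, P S ≠ 0 → (S.card : ℝ) ≤ m) : N * B - m ≤ ∑ p, avoidProb P p := by
  unfold avoidProb
  have h0 : (N : ℝ) * B - m = ∑ S, P S * (N * B - m) := by rw [← Finset.sum_mul, hP.2, one_mul]
  rw [Finset.sum_comm, h0]
  refine Finset.sum_le_sum fun S _ => ?_
  rw [← Finset.mul_sum]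
  by_cases h : P S = 0
  · rw [h, zero_mul, zero_mul]
  · refine mul_le_mul_of_nonneg_left ?_ (hP.1 S)
    have h1 : ∑ p, (if p ∉ S then (1 : ℝ) else 0) = (Sᶜ.card : ℝ) := by
      rw [Finset.sum_boole]
      congr 2
      ext; simp
    have h2 := hm S h
    rw [h1, Finset.card_compl, Nat.cast_sub (Finset.card_le_univ _)]
    simp only [Fintype.card_prod, Fintype.card_fin, Nat.cast_mul]
    linarith

/-- Power mean inequality: the average over bits of the avoidance probability is at least `1 - M /
N`. -/
theorem mul_pow_le_sum_avoidProb_pow {P : Finset (Fin N × Fin B) → ℝ}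
    (hP : P ∈ stdSimplex ℝ (Finset (Fin N × Fin B))) (hN : 0 < N) (hB : 0 < B) {M : ℝ} (hM : M ≤ N)
    (hm : ∀ S, P S ≠ 0 → (S.card : ℝ) ≤ M * B) (j : ℕ) :
    N * B * (1 - M / N) ^ (j + 1) ≤ ∑ p, avoidProb P p ^ (j + 1) := by
  have hN' : (0 : ℝ) < N := by exact_mod_cast hN
  have hB' : (0 : ℝ) < B := by exact_mod_cast hB
  have h0 : ∀ p, 0 ≤ avoidProb P p := fun p => Finset.sum_nonneg fun S _ =>
    mul_nonneg (hP.1 S) (by split_ifs <;> norm_num)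
  have h1 := pow_sum_le_card_mul_sum_pow (s := univ) (fun p _ => h0 p) j
  have h2 := le_sum_avoidProb hP hm
  have h3 : (N : ℝ) * B - M * B = N * B * (1 - M / N) := by field_simp
  have h4 : 0 ≤ (N : ℝ) * B * (1 - M / N) := by
    rw [← h3]; nlinarith
  rw [h3] at h2
  have h5 := (pow_le_pow_left₀ h4 h2 (j + 1)).trans h1
  rw [mul_pow, pow_succ ((N : ℝ) * B)] at h5
  simp only [Finset.card_univ, Fintype.card_prod, Fintype.card_fin, Nat.cast_mul] at h5
  rw [mul_assoc] at h5
  exact le_of_mul_le_mul_left h5 (by positivity)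

theorem decentralizedLoad_eq_sum (hN : 0 < N) {M : ℝ} (hM : 0 < M) : decentralizedLoad K N M =
    ∑ j ∈ range (min K N), (1 - M / N) ^ (j + 1) := by
  have hq : M / N ≠ 0 := by positivity
  have h := geom_sum_mul_neg (1 - M / N : ℝ) (min K N)
  rw [sub_sub_cancel] at h
  rw [decentralizedLoad, ← h]
  simp only [pow_succ, ← Finset.sum_mul]
  field_simp

theorem decentralizedLoad_le_of_achievable (hN : 0 < N) {M : ℝ} (hM0 : 0 < M) (hM : M ≤ N)
    {R : ℝ} (hR : DecentralizedAchievable K N M R) : decentralizedLoad K N M ≤ R := by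
  have : NeZero N := ⟨hN.ne'⟩
  have hN' : (0 : ℝ) < N := by exact_mod_cast hN
  by_contra! hlt
  set Δ := decentralizedLoad K N M - R
  have hΔ : 0 < Δ := sub_pos.2 hlt
  -- With this error level, the correction `2 * N * B * ε` for unreliable placements is `Δ / 2 * B`,
  -- half of the assumed gap.
  have hev := hR (Δ / (4 * N)) (by positivity)
  have hlarge := (tendsto_natCast_atTop_atTop (R := ℝ)).eventually_gt_atTop (2 / Δ)
  obtain ⟨B, ⟨⟨P, hP, hm, hd⟩, hB⟩, hB0⟩ := ((hev.and hlarge).and (eventually_gt_atTop 0)).exists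
  rw [div_lt_iff₀ hΔ] at hB
  have hPtot := sum_placement_eq_one (K := K) hP
  have hP0 : ∀ C : Placement K N B, 0 ≤ ∏ k, P (C k) := fun C =>
    Finset.prod_nonneg fun k _ => hP.1 _
  have hS : ∀ a : Fin N, ∑ C : Placement K N B, (∏ k, P (C k)) *
      ((acyclicBits C (shiftedDemands 1 a) (firstUsers N 1)).card : ℝ) ≤
      R * B + 1 + Δ / 2 * B := by
    intro a
    obtain ⟨L, hL, c, hc⟩ := hd (shiftedDemands 1 a)
    have hC : ∀ C : Placement K N B,
        ((acyclicBits C (shiftedDemands 1 a) (firstUsers N 1)).card : ℝ) ≤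
          (R * B + 1) + 2 * N * B * (c C).errorProb (shiftedDemands 1 a) := by
      intro C
      -- Only the average error is small, so a placement with error above one half gets the trivial
      -- bound `N * B`, at most `2 * N * B` times its error.
      by_cases he : (c C).errorProb (shiftedDemands 1 a) ≤ 1 / 2
      · have h1 : ((acyclicBits C (shiftedDemands 1 a) (firstUsers N 1)).card : ℝ) ≤ L + 1 := by
          exact_mod_cast card_acyclicBits_le (c C) he (firstUsers N 1)
        have h2 : 0 ≤ (c C).errorProb (shiftedDemands 1 a) := by
          unfold DeliveryCode.errorProb; positivity
        have h3 : 0 ≤ 2 * N * B * (c C).errorProb (shiftedDemands 1 a) := by positivity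
        linarith
      · have h1 : ((acyclicBits C (shiftedDemands 1 a) (firstUsers N 1)).card : ℝ) ≤ N * B := by
          exact_mod_cast (Finset.card_le_univ _).trans_eq (by simp)
        have h2 : (N : ℝ) * B * 1 ≤
            N * B * (2 * (c C).errorProb (shiftedDemands 1 a)) :=
          mul_le_mul_of_nonneg_left (by linarith) (by positivity)
        have h3 : (0 : ℝ) ≤ L := Nat.cast_nonneg _
        linarith
    calc _ ≤ ∑ C : Placement K N B, (∏ k, P (C k)) *
          ((R * B + 1) + 2 * N * B * (c C).errorProb (shiftedDemands 1 a)) :=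
          Finset.sum_le_sum fun C _ => mul_le_mul_of_nonneg_left (hC C) (hP0 C)
      _ = (R * B + 1) + 2 * N * B * ∑ C : Placement K N B,
          (∏ k, P (C k)) * (c C).errorProb (shiftedDemands 1 a) := by
          simp only [mul_add, Finset.sum_add_distrib, ← Finset.sum_mul, hPtot, one_mul,
            Finset.mul_sum]
          congr 1
          exact Finset.sum_congr rfl fun C _ => by ring
      _ ≤ (R * B + 1) + 2 * N * B * (Δ / (4 * N)) := by gcongr
      _ = _ := by field_simp; ring
  have h1 := Finset.sum_le_sum fun a (_ : a ∈ univ) => hS a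
  rw [Finset.sum_comm] at h1
  have h2 : ∀ C : Placement K N B, ∑ a : Fin N, (∏ k, P (C k)) *
      ((acyclicBits C (shiftedDemands 1 a) (firstUsers N 1)).card : ℝ) =
      ∑ j : Fin (min K N), ∑ p, (∏ k, P (C k)) *
        (if ∀ i ≤ j, p ∉ C (firstUsers N 1 i) then 1 else 0) := by
    intro C
    simp only [← Finset.mul_sum]
    congr 1
    rw [← Nat.cast_sum, sum_card_acyclicBits, Nat.cast_sum]
    exact Finset.sum_congr rfl fun j _ => by rw [Finset.sum_boole]
  rw [Finset.sum_congr rfl fun C _ => h2 C, Finset.sum_comm] at h1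
  have h3 : ∀ j : Fin (min K N), (N : ℝ) * B * (1 - M / N) ^ (j.val + 1) ≤
      ∑ C : Placement K N B, ∑ p, (∏ k, P (C k)) *
        (if ∀ i ≤ j, p ∉ C (firstUsers N 1 i) then 1 else 0) := by
    intro j
    rw [Finset.sum_comm, Finset.sum_congr rfl fun p _ => sum_prod_avoiding hP p j]
    exact mul_pow_le_sum_avoidProb_pow hP hN hB0 hM hm j
  have h4 := (Finset.sum_le_sum fun j (_ : j ∈ univ) => h3 j).trans h1
  rw [← Finset.mul_sum, Fin.sum_univ_eq_sum_range (fun j => (1 - M / N : ℝ) ^ (j + 1)),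
    ← decentralizedLoad_eq_sum hN hM0] at h4
  simp only [Finset.sum_const, Finset.card_univ, Fintype.card_fin, nsmul_eq_mul] at h4
  rw [mul_assoc] at h4
  have h5 := le_of_mul_le_mul_left h4 hN'
  have h6 : (B : ℝ) * decentralizedLoad K N M = R * B + Δ * B := by
    simp only [Δ]; ring
  linarith

end DecentralizedConverse

/-! ### Concentration of sub-file sizes -/

section Concentration

variable {K N B : ℕ}

/-- If a cache contains each bit of file `i` with probability `x` and each two of them with
probability at most `x ^ 2`, then the size of `F_{i,W}` has variance at most `B`. -/
theorem variance_card_subfile_le {P : Finset (Fin N × Fin B) → ℝ}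
    (hP : P ∈ stdSimplex ℝ (Finset (Fin N × Fin B))) (i : Fin N) {x : ℝ}
    (hx0 : 0 ≤ x) (hx1 : x ≤ 1) (h1 : ∀ b, ∑ S, P S * (if (i, b) ∈ S then 1 else 0) = x)
    (h2 : ∀ b b', b ≠ b' →
      ∑ S, P S * ((if (i, b) ∈ S then 1 else 0) * (if (i, b') ∈ S then 1 else 0)) ≤ x ^ 2)
    (W : Finset (Fin K)) :
    ∑ C : Placement K N B, (∏ k, P (C k)) *
      (((subfile C i W).card : ℝ) - (B : ℝ) * (x ^ W.card * (1 - x) ^ (K - W.card))) ^ 2 ≤ (B : ℝ) := by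
  set p := x ^ W.card * (1 - x) ^ (K - W.card)
  have hp0 : 0 ≤ p := mul_nonneg (pow_nonneg hx0 _) (pow_nonneg (sub_nonneg.2 hx1) _)
  have hp1 : p ≤ 1 := mul_le_one₀ (pow_le_one₀ hx0 hx1) (pow_nonneg (sub_nonneg.2 hx1) _)
    (pow_le_one₀ (sub_nonneg.2 hx1) (sub_le_self _ hx0))
  let f : Fin B → Fin K → Finset (Fin N × Fin B) → ℝ := fun b k S =>
    if k ∈ W then (if (i, b) ∈ S then 1 else 0) else 1 - (if (i, b) ∈ S then 1 else 0)
  have hf0 : ∀ b k S, 0 ≤ f b k S := by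
    intro b k S; simp only [f]; split_ifs <;> norm_num
  have hcard : ∀ C : Placement K N B, ((subfile C i W).card : ℝ) = ∑ b, ∏ k, f b k (C k) := by
    intro C
    rw [subfile, Finset.card_filter]
    push_cast
    refine Finset.sum_congr rfl fun b _ => ?_
    split_ifs with h
    · exact (Finset.prod_eq_one fun k _ => by
        by_cases hk : k ∈ W
        · simp [f, hk, (h k).2 hk]
        · simp [f, hk, mt (h k).1 hk]).symm
    · push Not at h
      obtain ⟨k, hk⟩ := h
      refine (Finset.prod_eq_zero (Finset.mem_univ k) ?_).symm
      rcases hk with ⟨hk, hk'⟩ | ⟨hk, hk'⟩ <;> simp [f, hk, hk']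
  have hprod : ∏ k, (if k ∈ W then x else 1 - x) = p := by
    rw [Finset.prod_ite, Finset.prod_const, Finset.prod_const]
    have e1 : (univ.filter fun k => k ∈ W) = W := by ext; simp
    have e2 : (univ.filter fun k => k ∉ W) = Wᶜ := by ext; simp
    rw [e1, e2, Finset.card_compl, Fintype.card_fin]
  have hmean : ∀ b, ∑ C : Placement K N B, (∏ k, P (C k)) * ∏ k, f b k (C k) = p := by
    intro b
    rw [sum_placement_prod, ← hprod]
    refine Finset.prod_congr rfl fun k _ => ?_
    by_cases hk : k ∈ W
    · simp only [f, hk, if_true]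
      exact h1 b
    · simp only [f, hk, if_false, mul_sub, mul_one, Finset.sum_sub_distrib, hP.2]
      rw [h1 b]
  -- Distinct bits are nonpositively correlated in each cache, and so are their complements. Only
  -- the diagonal pairs contribute to the variance bound, at most one for each bit.
  have hpair : ∀ b b', ∑ C : Placement K N B, (∏ k, P (C k)) *
      ((∏ k, f b k (C k)) * ∏ k, f b' k (C k)) ≤ p ^ 2 + if b = b' then 1 else 0 := by
    intro b b'
    by_cases hb : b = b'
    · subst hb
      have : ∀ C : Placement K N B, (∏ k, f b k (C k)) * (∏ k, f b k (C k)) =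
          ∏ k, f b k (C k) := by
        intro C
        rw [← Finset.prod_mul_distrib]
        refine Finset.prod_congr rfl fun k _ => ?_
        simp only [f]; split_ifs <;> norm_num
      rw [Finset.sum_congr rfl fun C _ => by rw [this C], hmean, if_pos rfl]
      nlinarith [sq_nonneg p]
    · rw [if_neg hb, add_zero]
      have e : ∀ C : Placement K N B, (∏ k, f b k (C k)) * (∏ k, f b' k (C k)) =
          ∏ k, (f b k (C k) * f b' k (C k)) := fun C => Finset.prod_mul_distrib.symm
      rw [Finset.sum_congr rfl fun C _ => by rw [e C],
        sum_placement_prod P fun k S => f b k S * f b' k S, ← hprod, ← Finset.prod_pow]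
      refine Finset.prod_le_prod (fun k _ => Finset.sum_nonneg fun S _ =>
        mul_nonneg (hP.1 S) (mul_nonneg (hf0 _ _ _) (hf0 _ _ _))) fun k _ => ?_
      by_cases hk : k ∈ W
      · simp only [f, hk, if_true]
        exact h2 b b' hb
      · simp only [f, hk, if_false]
        have : ∀ S, P S * ((1 - if (i, b) ∈ S then (1 : ℝ) else 0) *
            (1 - if (i, b') ∈ S then (1 : ℝ) else 0)) =
            P S - P S * (if (i, b) ∈ S then 1 else 0) - P S * (if (i, b') ∈ S then 1 else 0) +
            P S * ((if (i, b) ∈ S then 1 else 0) * (if (i, b') ∈ S then 1 else 0)) :=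
          fun S => by ring
        rw [Finset.sum_congr rfl fun S _ => this S, Finset.sum_add_distrib,
          Finset.sum_sub_distrib, Finset.sum_sub_distrib, hP.2, h1, h1]
        have := h2 b b' hb
        linarith
  have hsq : ∀ C : Placement K N B, (∏ k, P (C k)) *
      (((subfile C i W).card : ℝ) - B * p) ^ 2 =
      (∑ b, ∑ b', (∏ k, P (C k)) * ((∏ k, f b k (C k)) * ∏ k, f b' k (C k))) -
      (2 * B * p) * ∑ b, ((∏ k, P (C k)) * ∏ k, f b k (C k)) +
      (B * p) ^ 2 * ∏ k, P (C k) := by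
    intro C
    simp only [← Finset.mul_sum]
    rw [← Finset.sum_mul, ← hcard]
    ring
  rw [Finset.sum_congr rfl fun C _ => hsq C, Finset.sum_add_distrib, Finset.sum_sub_distrib,
    ← Finset.mul_sum, ← Finset.mul_sum, sum_placement_eq_one hP]
  have e1 : ∑ C : Placement K N B, ∑ b, ((∏ k, P (C k)) * ∏ k, f b k (C k)) = B * p := by
    rw [Finset.sum_comm, Finset.sum_congr rfl fun b _ => hmean b]
    simp
  have e2 : ∑ C : Placement K N B, ∑ b, ∑ b', (∏ k, P (C k)) *
      ((∏ k, f b k (C k)) * ∏ k, f b' k (C k)) ≤ (B * p) ^ 2 + B := by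
    rw [Finset.sum_comm]
    calc _ = ∑ b, ∑ b', ∑ C : Placement K N B, (∏ k, P (C k)) *
          ((∏ k, f b k (C k)) * ∏ k, f b' k (C k)) :=
          Finset.sum_congr rfl fun b _ => Finset.sum_comm
      _ ≤ ∑ b, ∑ b', (p ^ 2 + if b = b' then 1 else 0) :=
          Finset.sum_le_sum fun b _ => Finset.sum_le_sum fun b' _ => hpair b b'
      _ = _ := by
          simp only [Finset.sum_add_distrib, Finset.sum_ite_eq, Finset.mem_univ, if_true,
            Finset.sum_const, Finset.card_univ, Fintype.card_fin, nsmul_eq_mul]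
          ring
  rw [e1]
  linarith

/-- Chebyshev's inequality and a union bound over the `N * 2 ^ K` sub-files. -/
theorem prob_subfile_large_le {P : Finset (Fin N × Fin B) → ℝ}
    (hP : P ∈ stdSimplex ℝ (Finset (Fin N × Fin B))) {x : ℝ} (hx0 : 0 ≤ x) (hx1 : x ≤ 1)
    (h1 : ∀ i b, ∑ S, P S * (if (i, b) ∈ S then 1 else 0) = x)
    (h2 : ∀ i b b', b ≠ b' →
      ∑ S, P S * ((if (i, b) ∈ S then 1 else 0) * (if (i, b') ∈ S then 1 else 0)) ≤ x ^ 2)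
    (hB : 0 < B) {η : ℝ} (hη : 0 < η) {E : Placement K N B → Prop}
    (hE : ∀ C, (∀ i W, ((subfile C i W).card : ℝ) ≤
      (x ^ W.card * (1 - x) ^ (K - W.card) + η) * B) → E C) :
    ∑ C : Placement K N B, (∏ k, P (C k)) * (if E C then 0 else 1) ≤ N * 2 ^ K / (η ^ 2 * B) := by
  have hB' : (0 : ℝ) < B := by exact_mod_cast hB
  have hP0 : ∀ C : Placement K N B, 0 ≤ ∏ k, P (C k) := fun C =>
    Finset.prod_nonneg fun k _ => hP.1 _
  let t : Placement K N B → Fin N → Finset (Fin K) → ℝ := fun C i W =>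
    (((subfile C i W).card : ℝ) - (B : ℝ) * (x ^ W.card * (1 - x) ^ (K - W.card))) ^ 2
  have ht : ∀ C i W, 0 ≤ t C i W / (η * B) ^ 2 := fun C i W =>
    div_nonneg (sq_nonneg _) (sq_nonneg _)
  have hle : ∀ C i W, t C i W / (η * B) ^ 2 ≤ ∑ i, ∑ W, t C i W / (η * B) ^ 2 := fun C i W =>
    (Finset.single_le_sum (fun W _ => ht C i W) (Finset.mem_univ W)).trans
      (Finset.single_le_sum (f := fun i => ∑ W, t C i W / (η * B) ^ 2)
        (fun i _ => Finset.sum_nonneg fun W _ => ht C i W) (Finset.mem_univ i))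
  calc _ ≤ ∑ C : Placement K N B, (∏ k, P (C k)) * ∑ i, ∑ W, t C i W / (η * B) ^ 2 := by
        refine Finset.sum_le_sum fun C _ => mul_le_mul_of_nonneg_left ?_ (hP0 C)
        split_ifs with h
        · exact Finset.sum_nonneg fun i _ => Finset.sum_nonneg fun W _ => ht C i W
        · replace h := mt (hE C) h
          push Not at h
          obtain ⟨i, W, h⟩ := h
          refine le_trans ?_ (hle C i W)
          rw [one_le_div (by positivity)]
          refine pow_le_pow_left₀ (by positivity) ?_ 2
          linarith
    _ = ∑ i : Fin N, ∑ W : Finset (Fin K), (∑ C : Placement K N B, (∏ k, P (C k)) *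
        t C i W) / (η * B) ^ 2 := by
        simp only [Finset.mul_sum, Finset.sum_div, mul_div_assoc]
        rw [Finset.sum_comm]
        exact Finset.sum_congr rfl fun i _ => Finset.sum_comm
    _ ≤ ∑ i : Fin N, ∑ W : Finset (Fin K), (B : ℝ) / (η * B) ^ 2 :=
        Finset.sum_le_sum fun i _ => Finset.sum_le_sum fun W _ =>
          div_le_div_of_nonneg_right (variance_card_subfile_le hP i hx0 hx1 (h1 i) (h2 i) W)
            (by positivity)
    _ = _ := by
        simp only [Finset.sum_const, Finset.card_univ, Fintype.card_fin, Fintype.card_finset,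
          nsmul_eq_mul]
        push_cast
        field_simp

/-- The uniform distribution on the caches with `⌊M B / N⌋` bits of each file. -/
def uniformCache (N B : ℕ) (M : ℝ) (S : Finset (Fin N × Fin B)) : ℝ :=
  if S ∈ decentralizedMANCaches N B M then 1 / (decentralizedMANCaches N B M).card else 0

theorem floor_le_of_le (hN : 0 < N) {M : ℝ} (hM : M ≤ N) : ⌊M * B / N⌋₊ ≤ B := by
  refine Nat.floor_le_of_le ?_
  have hN' : (0 : ℝ) < N := by exact_mod_cast hN
  rw [div_le_iff₀ hN', mul_comm]
  exact mul_le_mul_of_nonneg_left hM (Nat.cast_nonneg _)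

theorem decentralizedMANCaches_nonempty (hN : 0 < N) {M : ℝ} (hM : M ≤ N) :
    (decentralizedMANCaches N B M).Nonempty := by
  obtain ⟨s, -, hs⟩ := Finset.exists_subset_card_eq (s := (univ : Finset (Fin B)))
    (n := ⌊M * B / N⌋₊) (by simpa using floor_le_of_le hN hM)
  refine ⟨univ ×ˢ s, ?_⟩
  simp only [decentralizedMANCaches, mem_filter, mem_univ, true_and]
  intro i
  have : ((univ ×ˢ s : Finset (Fin N × Fin B)).filter fun p => p.1 = i) = {i} ×ˢ s := by
    ext p
    simp only [mem_filter, mem_product, mem_univ, true_and, mem_singleton, and_comm]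
  rw [this, Finset.card_product, Finset.card_singleton, one_mul, hs]

theorem uniformCache_mem (hN : 0 < N) {M : ℝ} (hM : M ≤ N) :
    uniformCache N B M ∈ stdSimplex ℝ (Finset (Fin N × Fin B)) := by
  refine ⟨fun S => by unfold uniformCache; split_ifs <;> positivity, ?_⟩
  have : ((decentralizedMANCaches N B M).card : ℝ) ≠ 0 := by
    exact_mod_cast (Finset.card_pos.2 (decentralizedMANCaches_nonempty hN hM)).ne'
  simp [uniformCache, Finset.sum_ite_mem, this]

theorem decentralizedMANProb_eq (K N B : ℕ) (M : ℝ) (E : Placement K N B → Prop) :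
    decentralizedMANProb K N B M E =
      ∑ C : Placement K N B, (∏ k, uniformCache N B M (C k)) * if E C then 1 else 0 := by
  have h : ∀ C : Placement K N B, (∏ k, uniformCache N B M (C k)) =
      if C ∈ Fintype.piFinset fun _ : Fin K => decentralizedMANCaches N B M then
        1 / ((Fintype.piFinset fun _ : Fin K => decentralizedMANCaches N B M).card : ℝ) else 0 := by
    intro C
    split_ifs with h
    · rw [Fintype.mem_piFinset] at h
      rw [Fintype.card_piFinset_const]
      simp [uniformCache, h]
    · rw [Fintype.mem_piFinset] at h
      push Not at h
      obtain ⟨k, hk⟩ := h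
      exact Finset.prod_eq_zero (Finset.mem_univ k) (by simp [uniformCache, hk])
  simp only [h]
  rw [decentralizedMANProb, Finset.card_filter]
  push_cast
  rw [Finset.sum_div, ← Finset.sum_filter_add_sum_filter_not univ
    (fun C => C ∈ Fintype.piFinset fun _ : Fin K => decentralizedMANCaches N B M)]
  rw [Finset.sum_eq_zero (s := univ.filter fun C => C ∉ _), add_zero]
  · refine Finset.sum_congr (by ext; simp) fun C hC => ?_
    rw [if_pos (Finset.mem_filter.1 hC).2]
    ring
  · intro C hC
    rw [if_neg (Finset.mem_filter.1 hC).2, zero_mul]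

theorem uniformCache_map (M : ℝ) (τ : Equiv.Perm (Fin B)) (S : Finset (Fin N × Fin B)) :
    uniformCache N B M (S.map ((Equiv.refl _).prodCongr τ).toEmbedding) = uniformCache N B M S := by
  have : S.map ((Equiv.refl _).prodCongr τ).toEmbedding ∈ decentralizedMANCaches N B M ↔
      S ∈ decentralizedMANCaches N B M := by
    simp only [decentralizedMANCaches, mem_filter, mem_univ, true_and]
    refine forall_congr' fun i => ?_
    rw [Finset.filter_map, Finset.card_map]
    rfl
  simp only [uniformCache, this]

/-- Exchangeability of bit positions: it reduces the one-bit and two-bit marginals to totals, which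
are fixed by the number of cached bits. -/
theorem sum_uniformCache_perm (M : ℝ) (τ : Equiv.Perm (Fin B))
    (f : Finset (Fin N × Fin B) → ℝ) :
    ∑ S, uniformCache N B M S * f (S.map ((Equiv.refl _).prodCongr τ).toEmbedding) =
      ∑ S, uniformCache N B M S * f S := by
  refine Eq.trans ?_ (Equiv.sum_comp ((Equiv.refl (Fin N)).prodCongr τ).finsetCongr
    fun S => uniformCache N B M S * f S)
  refine Finset.sum_congr rfl fun S _ => ?_
  simp only [Equiv.finsetCongr_apply]
  rw [uniformCache_map]

theorem mem_map_perm {τ : Equiv.Perm (Fin B)} {S : Finset (Fin N × Fin B)} {i : Fin N}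
    {b : Fin B} :
    (i, τ b) ∈ S.map ((Equiv.refl _).prodCongr τ).toEmbedding ↔ (i, b) ∈ S := by
  simp

theorem uniformCache_mul_sum (M : ℝ) (i : Fin N) (S : Finset (Fin N × Fin B)) :
    uniformCache N B M S * ∑ b, (if (i, b) ∈ S then 1 else 0) =
      uniformCache N B M S * ⌊M * B / N⌋₊ := by
  by_cases hS : S ∈ decentralizedMANCaches N B M
  · congr 1
    rw [Finset.sum_boole, ← (Finset.mem_filter.1 hS).2 i]
    congr 1
    refine Finset.card_bij (fun b _ => (i, b)) ?_ ?_ ?_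
    · intro b hb
      simpa using hb
    · intro b _ b' _ h
      exact (Prod.mk_inj.1 h).2
    · rintro ⟨i', b⟩ hb
      obtain ⟨h1, rfl⟩ := Finset.mem_filter.1 hb
      exact ⟨b, by simpa using h1, rfl⟩
  · simp [uniformCache, hS]

theorem uniformCache_single (hN : 0 < N) {M : ℝ} (hM : M ≤ N) (i : Fin N) (b : Fin B) :
    ∑ S, uniformCache N B M S * (if (i, b) ∈ S then 1 else 0) = ⌊M * B / N⌋₊ / B := by
  have hB : (B : ℝ) ≠ 0 := by exact_mod_cast b.pos.ne'
  rw [eq_div_iff hB]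
  have hsym : ∀ c, ∑ S, uniformCache N B M S * (if (i, c) ∈ S then 1 else 0) =
      ∑ S, uniformCache N B M S * (if (i, b) ∈ S then 1 else 0) := by
    intro c
    rw [← sum_uniformCache_perm M (Equiv.swap b c)]
    refine Finset.sum_congr rfl fun S _ => ?_
    have := mem_map_perm (τ := Equiv.swap b c) (S := S) (i := i) (b := b)
    rw [Equiv.swap_apply_left] at this
    simp only [this]
  calc _ = ∑ c : Fin B, ∑ S, uniformCache N B M S * (if (i, b) ∈ S then 1 else 0) := by
        simp [mul_comm]
    _ = ∑ c : Fin B, ∑ S, uniformCache N B M S * (if (i, c) ∈ S then 1 else 0) :=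
        Finset.sum_congr rfl fun c _ => (hsym c).symm
    _ = ∑ S, uniformCache N B M S * ⌊M * B / N⌋₊ := by
        rw [Finset.sum_comm]
        refine Finset.sum_congr rfl fun S _ => ?_
        rw [← Finset.mul_sum, uniformCache_mul_sum]
    _ = _ := by rw [← Finset.sum_mul, (uniformCache_mem hN hM).2, one_mul]

theorem uniformCache_pair (hN : 0 < N) {M : ℝ} (hM : M ≤ N) (i : Fin N) {b b' : Fin B}
    (hb : b ≠ b') :
    ∑ S, uniformCache N B M S * ((if (i, b) ∈ S then 1 else 0) * (if (i, b') ∈ S then 1 else 0)) ≤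
      (⌊M * B / N⌋₊ / B : ℝ) ^ 2 := by
  have hB : (0 : ℝ) < B := by exact_mod_cast b.pos
  have hB1 : (1 : ℝ) < B := by
    have : 1 < B := by
      by_contra h
      exact hb (Fin.ext (by omega))
    exact_mod_cast this
  have hg : ((⌊M * B / N⌋₊ : ℕ) : ℝ) ≤ B := by exact_mod_cast floor_le_of_le hN hM
  set g : ℝ := ((⌊M * B / N⌋₊ : ℕ) : ℝ) with hgdef
  have hg0 : 0 ≤ g := Nat.cast_nonneg _
  set y := ∑ S, uniformCache N B M S *
    ((if (i, b) ∈ S then 1 else 0) * (if (i, b') ∈ S then (1 : ℝ) else 0)) with hy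
  have hsym : ∀ c ∈ univ.erase b, ∑ S, uniformCache N B M S *
      ((if (i, b) ∈ S then 1 else 0) * (if (i, c) ∈ S then 1 else 0)) = y := by
    intro c hc
    rw [hy, ← sum_uniformCache_perm M (Equiv.swap b' c)]
    refine Finset.sum_congr rfl fun S _ => ?_
    have h1 := mem_map_perm (τ := Equiv.swap b' c) (S := S) (i := i) (b := b')
    have h2 := mem_map_perm (τ := Equiv.swap b' c) (S := S) (i := i) (b := b)
    rw [Equiv.swap_apply_left] at h1
    rw [Equiv.swap_apply_of_ne_of_ne hb (Finset.ne_of_mem_erase hc).symm] at h2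
    simp only [h1, h2]
  -- Swapping `b'` with `c` fixes `b`, so all pairs containing `b` are equally likely. Hence `y = g
  -- (g - 1) / (B (B - 1))`, as in sampling without replacement, and the claim reduces to `g ≤ B`.
  have htot : (B - 1) * y = (g - 1) * (g / B) := by
    have e1 : ∑ c ∈ univ.erase b, ∑ S, uniformCache N B M S *
        ((if (i, b) ∈ S then 1 else 0) * (if (i, c) ∈ S then 1 else 0)) = (B - 1) * y := by
      rw [Finset.sum_congr rfl hsym, Finset.sum_const, Finset.card_erase_of_mem (Finset.mem_univ _),
        nsmul_eq_mul, Finset.card_univ, Fintype.card_fin, Nat.cast_sub b.pos, Nat.cast_one]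
    rw [← e1, Finset.sum_erase_eq_sub (Finset.mem_univ _), Finset.sum_comm,
      ← uniformCache_single hN hM i b, Finset.mul_sum, ← Finset.sum_sub_distrib]
    refine Finset.sum_congr rfl fun S _ => ?_
    have h1 := uniformCache_mul_sum M i S
    rw [← Finset.mul_sum, ← Finset.mul_sum, mul_left_comm, h1, ← hgdef]
    split_ifs <;> ring
  have h3 : y = (g - 1) * (g / B) / (B - 1) := by
    rw [eq_div_iff (by linarith), mul_comm, htot]
  rw [h3, div_le_iff₀ (by linarith), sq, mul_assoc, mul_comm (g / B) (B - 1), ← mul_assoc]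
  refine mul_le_mul_of_nonneg_right ?_ (by positivity)
  rw [div_mul_eq_mul_div, le_div_iff₀ hB]
  linarith

end Concentration

/-! ### Achievability under decentralized placement -/

section Decentralized

variable {K N B : ℕ}

/-- The binomial expansion of `(q + y) ^ n = 1` without its term `y ^ n`, multiplied by `y ^ (K - n
+ 1)`. -/
theorem mul_sum_choose_succ {q y : ℝ} (h : q + y = 1) {n K : ℕ} (hn : n ≤ K) :
    q * ∑ w ∈ range K, (n.choose (w + 1) : ℝ) * (q ^ w * y ^ (K - w)) =
      y ^ (K - n + 1) * (1 - y ^ n) := by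
  have h1 : ∑ w ∈ range K, (n.choose (w + 1) : ℝ) * (q ^ w * y ^ (K - w)) =
      ∑ w ∈ range n, (n.choose (w + 1) : ℝ) * (q ^ w * y ^ (K - w)) := by
    refine (Finset.sum_subset (Finset.range_mono hn) fun w _ hw => ?_).symm
    rw [Finset.mem_range, not_lt] at hw
    rw [Nat.choose_eq_zero_of_lt (by omega), Nat.cast_zero, zero_mul]
  have h2 := add_pow q y n
  rw [h, one_pow, Finset.sum_range_succ'] at h2
  simp only [pow_zero, one_mul, Nat.sub_zero, Nat.choose_zero_right, Nat.cast_one, mul_one] at h2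
  rw [h1, h2, add_sub_cancel_right, Finset.mul_sum, Finset.mul_sum]
  refine Finset.sum_congr rfl fun w hw => ?_
  rw [Finset.mem_range] at hw
  have : K - w = (K - n + 1) + (n - (w + 1)) := by omega
  rw [this, pow_add]
  ring

/-- The load is the cost of the multicast scheme when each sub-file has its limiting expected size.
It follows from `mul_sum_choose_succ` with `n = K` and `n = K - min K N`. -/
theorem decentralizedLoad_eq_sum_multicastCount (hN : 0 < N) {M : ℝ} (hM : 0 < M) :
    decentralizedLoad K N M =
      ∑ w ∈ range K, (multicastCount K N w : ℝ) * ((M / N) ^ w * (1 - M / N) ^ (K - w)) := by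
  have hq : M / N ≠ 0 := by positivity
  have h1 := mul_sum_choose_succ (add_sub_cancel (M / N) 1) (le_refl K)
  have h2 := mul_sum_choose_succ (add_sub_cancel (M / N) 1) (Nat.sub_le K (min K N))
  have h3 : K - (K - min K N) = min K N := Nat.sub_sub_self (min_le_left _ _)
  have h4 : (1 - M / N) ^ K = (1 - M / N) ^ min K N * (1 - M / N) ^ (K - min K N) := by
    rw [← pow_add, Nat.add_sub_cancel' (min_le_left _ _)]
  rw [Nat.sub_self, zero_add, pow_one] at h1
  rw [h3, pow_succ] at h2
  simp only [multicastCount_cast, sub_mul, Finset.sum_sub_distrib]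
  refine mul_left_cancel₀ hq ?_
  rw [mul_sub, h1, h2, h4, decentralizedLoad]
  field_simp
  ring

/-- All sub-files have at most `η * B` bits more than their limiting expected size. -/
def IsTypical (M η : ℝ) (C : Placement K N B) : Prop :=
  ∀ i W, ((subfile C i W).card : ℝ) ≤ ((M / N) ^ W.card * (1 - M / N) ^ (K - W.card) + η) * B

theorem decentralizedMANProb_mono (hN : 0 < N) {M : ℝ} (hM : M ≤ N)
    {E E' : Placement K N B → Prop} (h : ∀ C, E C → E' C) :
    decentralizedMANProb K N B M E ≤ decentralizedMANProb K N B M E' := by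
  rw [decentralizedMANProb_eq, decentralizedMANProb_eq]
  refine Finset.sum_le_sum fun C _ => mul_le_mul_of_nonneg_left ?_
    (Finset.prod_nonneg fun k _ => (uniformCache_mem hN hM).1 _)
  by_cases hE : E C
  · rw [if_pos hE, if_pos (h C hE)]
  · rw [if_neg hE]; split_ifs <;> norm_num

theorem decentralizedMANProb_true (hN : 0 < N) {M : ℝ} (hM : M ≤ N) :
    decentralizedMANProb K N B M (fun _ => True) = 1 := by
  rw [decentralizedMANProb_eq]
  simpa using sum_placement_eq_one (uniformCache_mem hN hM)

theorem decentralizedMANProb_not (hN : 0 < N) {M : ℝ} (hM : M ≤ N)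
    (E : Placement K N B → Prop) :
    ∑ C : Placement K N B, (∏ k, uniformCache N B M (C k)) * (if E C then 0 else 1) =
      1 - decentralizedMANProb K N B M E := by
  rw [decentralizedMANProb_eq, eq_sub_iff_add_eq, ← Finset.sum_add_distrib]
  refine Eq.trans ?_ (sum_placement_eq_one (K := K) (uniformCache_mem (B := B) hN hM))
  refine Finset.sum_congr rfl fun C _ => ?_
  split_ifs <;> ring

theorem tendsto_prob_isTypical (K : ℕ) (hN : 0 < N) {M : ℝ} (hM0 : 0 < M) (hM : M ≤ N) {η : ℝ}
    (hη : 0 < η) :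
    Tendsto (fun B : ℕ => decentralizedMANProb K N B M (IsTypical M η)) atTop (𝓝 1) := by
  have hx : Tendsto (fun B : ℕ => (⌊M * B / N⌋₊ / B : ℝ)) atTop (𝓝 (M / N)) := by
    have := (tendsto_nat_floor_mul_div_atTop (R := ℝ) (a := M / N) (by positivity)).comp
      tendsto_natCast_atTop_atTop
    refine this.congr fun B => ?_
    rw [Function.comp_apply, div_mul_eq_mul_div]
  -- The exact fraction cached is `⌊M * B / N⌋₊ / B`, not `M / N`. Half of `η` covers this rounding
  -- and the other half the random fluctuation.
  have hev : ∀ᶠ B : ℕ in atTop, ∀ w ∈ range (K + 1),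
      (⌊M * B / N⌋₊ / B : ℝ) ^ w * (1 - (⌊M * B / N⌋₊ / B : ℝ)) ^ (K - w) <
        (M / N) ^ w * (1 - M / N) ^ (K - w) + η / 2 := by
    rw [Filter.eventually_all_finset]
    intro w _
    have h := (hx.pow w).mul ((hx.const_sub 1).pow (K - w))
    exact h.eventually_lt_const (by linarith)
  have hlow : Tendsto (fun B : ℕ => 1 - (N * 2 ^ K / (η / 2) ^ 2 : ℝ) / B) atTop (𝓝 1) := by
    have := (tendsto_const_div_atTop_nhds_zero_nat (N * 2 ^ K / (η / 2) ^ 2 : ℝ)).const_sub 1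
    rwa [sub_zero] at this
  refine tendsto_of_tendsto_of_tendsto_of_le_of_le' hlow tendsto_const_nhds ?_ ?_
  · filter_upwards [hev, eventually_gt_atTop 0] with B hB hB0
    have hB' : (0 : ℝ) < B := by exact_mod_cast hB0
    set x : ℝ := ⌊M * B / N⌋₊ / B
    have hx1 : x ≤ 1 := by
      rw [div_le_one hB']
      exact_mod_cast floor_le_of_le hN hM
    have h1 := prob_subfile_large_le (K := K) (E := IsTypical M η) (uniformCache_mem hN hM)
      (by positivity) hx1 (uniformCache_single hN hM)
      (fun i b b' => uniformCache_pair hN hM i) hB0 (half_pos hη) fun C hC i W => by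
        refine (hC i W).trans (mul_le_mul_of_nonneg_right ?_ hB'.le)
        have := hB W.card (Finset.mem_range_succ_iff.2
          ((Finset.card_le_univ _).trans_eq (Fintype.card_fin K)))
        linarith
    rw [decentralizedMANProb_not hN hM] at h1
    rw [div_div]
    linarith
  · refine Eventually.of_forall fun B => ?_
    rw [← decentralizedMANProb_true (K := K) (B := B) hN hM]
    exact decentralizedMANProb_mono hN hM fun _ _ => trivial

/-- A margin for the sub-file sizes that increases the load by at most `δ`. -/
theorem exists_margin (K : ℕ) (hN : 0 < N) {M : ℝ} (hM0 : 0 < M) {δ : ℝ} (hδ : 0 < δ) :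
    ∃ η > 0, ∑ w ∈ range K, (multicastCount K N w : ℝ) *
      ((M / N) ^ w * (1 - M / N) ^ (K - w) + η) ≤ decentralizedLoad K N M + δ := by
  set T := ∑ w ∈ range K, (multicastCount K N w : ℝ)
  have hT : 0 ≤ T := Finset.sum_nonneg fun _ _ => Nat.cast_nonneg _
  refine ⟨δ / (T + 1), by positivity, ?_⟩
  simp only [mul_add, Finset.sum_add_distrib]
  rw [← decentralizedLoad_eq_sum_multicastCount hN hM0, ← Finset.sum_mul]
  have : T * (δ / (T + 1)) ≤ δ := by
    rw [← mul_div_assoc, div_le_iff₀ (by positivity)]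
    nlinarith
  linarith

theorem typical_size_nonneg (hN : 0 < N) {M η : ℝ} (hM0 : 0 < M) (hM : M ≤ N) (hη : 0 < η)
    (w : ℕ) : 0 ≤ (M / N) ^ w * (1 - M / N) ^ (K - w) + η := by
  have hN' : (0 : ℝ) < N := by exact_mod_cast hN
  have : 0 ≤ 1 - M / N := sub_nonneg.2 ((div_le_one hN').2 hM)
  positivity

theorem tendsto_prob_novelDelivers (K : ℕ) (hN : 0 < N) {M : ℝ} (hM0 : 0 < M) (hM : M ≤ N) {δ : ℝ}
    (hδ : 0 < δ) :
    Tendsto (fun B : ℕ => decentralizedMANProb K N B M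
      (fun C => ∀ d : Fin K → Fin N, NovelDelivers C d (decentralizedLoad K N M + δ)))
      atTop (𝓝 1) := by
  obtain ⟨η, hη, hle⟩ := exists_margin K hN hM0 hδ
  refine tendsto_of_tendsto_of_tendsto_of_le_of_le (tendsto_prob_isTypical K hN hM0 hM hη)
    tendsto_const_nhds (fun B => ?_) (fun B => ?_)
  · exact decentralizedMANProb_mono hN hM fun C hC d => novelDelivers_of_card_le C
      (fun w => (M / N) ^ w * (1 - M / N) ^ (K - w) + η)
      (typical_size_nonneg hN hM0 hM hη) hC hle d
  · rw [← decentralizedMANProb_true (K := K) (B := B) hN hM]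
    exact decentralizedMANProb_mono hN hM fun _ _ => trivial

theorem DeliveryCode.errorProb_le_one {C : Placement K N B} {L : ℕ} (c : DeliveryCode C L)
    (d : Fin K → Fin N) : c.errorProb d ≤ 1 := by
  rw [DeliveryCode.errorProb, div_le_one (by exact_mod_cast Fintype.card_pos)]
  exact_mod_cast Finset.card_le_univ _

theorem card_le_of_uniformCache_ne_zero (hN : 0 < N) {M : ℝ} (hM0 : 0 < M)
    {S : Finset (Fin N × Fin B)} (hS : uniformCache N B M S ≠ 0) : (S.card : ℝ) ≤ M * B := by
  have hN' : (0 : ℝ) < N := by exact_mod_cast hN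
  have hmem : S ∈ decentralizedMANCaches N B M := by
    by_contra h
    exact hS (if_neg h)
  have hcard := Finset.card_eq_sum_card_fiberwise (s := S) (t := univ) (f := Prod.fst)
    (fun _ _ => Finset.mem_coe.2 (Finset.mem_univ _))
  rw [Finset.sum_congr rfl fun i _ => (Finset.mem_filter.1 hmem).2 i] at hcard
  rw [hcard]
  simp only [Finset.sum_const, Finset.card_univ, Fintype.card_fin, smul_eq_mul, Nat.cast_mul]
  have := Nat.floor_le (show 0 ≤ M * B / N by positivity)
  rwa [le_div_iff₀ hN', mul_comm] at this

theorem decentralizedAchievable_of_lt (hN : 0 < N) {M : ℝ} (hM0 : 0 < M) (hM : M ≤ N) {R : ℝ}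
    (hR : decentralizedLoad K N M < R) : DecentralizedAchievable K N M R := by
  intro ε hε
  obtain ⟨η, hη, hle⟩ := exists_margin K hN hM0 (sub_pos.2 hR)
  rw [add_sub_cancel] at hle
  have hev := (tendsto_prob_isTypical K hN hM0 hM hη).eventually_const_le
    (show 1 - ε < 1 by linarith)
  filter_upwards [hev] with B hB
  let s : ℕ → ℝ := fun w => (M / N) ^ w * (1 - M / N) ^ (K - w) + η
  have hs : ∀ w, 0 ≤ s w := typical_size_nonneg hN hM0 hM hη
  refine ⟨uniformCache N B M, uniformCache_mem hN hM,
    fun S hS => card_le_of_uniformCache_ne_zero hN hM0 hS, fun d =>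
    ⟨∑ w ∈ range K, multicastCount K N w * ⌊s w * B⌋₊, ?_, ?_⟩⟩
  · push_cast
    calc _ ≤ ∑ w ∈ range K, (multicastCount K N w : ℝ) * (s w * B) :=
          Finset.sum_le_sum fun w _ => mul_le_mul_of_nonneg_left
            (Nat.floor_le (mul_nonneg (hs w) (Nat.cast_nonneg _))) (Nat.cast_nonneg _)
      _ = (∑ w ∈ range K, (multicastCount K N w : ℝ) * s w) * B := by
          rw [Finset.sum_mul]
          exact Finset.sum_congr rfl fun w _ => by ring
      _ ≤ R * B := mul_le_mul_of_nonneg_right hle (Nat.cast_nonneg _)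
  · have hcode : ∀ C : Placement K N B,
        ∃ c : DeliveryCode C (∑ w ∈ range K, multicastCount K N w * ⌊s w * B⌋₊),
          c.errorProb d ≤ if IsTypical M η C then 0 else 1 := by
      intro C
      by_cases hC : IsTypical M η C
      · obtain ⟨c, hc⟩ := exists_deliveryCode_of_card_le C d (fun w => ⌊s w * B⌋₊)
          (fun i W => Nat.le_floor (hC i W)) le_rfl
        exact ⟨c, by rw [if_pos hC, hc]⟩
      · exact ⟨⟨fun _ _ => false, fun _ _ _ _ => false⟩, by
          rw [if_neg hC]; exact DeliveryCode.errorProb_le_one _ d⟩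
    choose c hc using hcode
    refine ⟨c, ?_⟩
    calc _ ≤ ∑ C : Placement K N B, (∏ k, uniformCache N B M (C k)) *
          (if IsTypical M η C then 0 else 1) :=
          Finset.sum_le_sum fun C _ => mul_le_mul_of_nonneg_left (hc C)
            (Finset.prod_nonneg fun k _ => (uniformCache_mem hN hM).1 _)
      _ = 1 - decentralizedMANProb K N B M (IsTypical M η) := decentralizedMANProb_not hN hM _
      _ ≤ ε := by linarith

end Decentralized

theorem isGLB_of_forall {S : Set ℝ} {ρ : ℝ} (h1 : ∀ R ∈ S, ρ ≤ R) (h2 : ∀ R, ρ < R → R ∈ S) :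
    IsGLB S ρ :=
  ⟨h1, fun _ hb => le_of_forall_gt_imp_ge_of_dense fun R hR => hb (h2 R hR)⟩

end CodedCaching

end

theorem theorem3 (K N : ℕ) (hK : 0 < K) (hN : 0 < N) :
    (∀ t : ℕ, t ≤ K →
      (∀ B : ℕ, 0 < B → K.choose t ∣ B →
        ∃ C : CodedCaching.Placement K N B,
          CodedCaching.IsCentralizedMAN t C ∧
          (∀ k, ((C k).card : ℝ) ≤ (t * N / K : ℝ) * B) ∧
          ∀ d : Fin K → Fin N,
            CodedCaching.NovelDelivers C d (CodedCaching.centralizedLoad K N t)) ∧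
      IsGLB {R : ℝ | CodedCaching.CentralizedAchievable K N (t * N / K : ℝ) R}
        (CodedCaching.centralizedLoad K N t)) ∧
    (∀ M : ℝ, 0 < M → M ≤ N →
      (∀ δ > 0, Tendsto
        (fun B : ℕ => CodedCaching.decentralizedMANProb K N B M
          (fun C => ∀ d : Fin K → Fin N,
            CodedCaching.NovelDelivers C d (CodedCaching.decentralizedLoad K N M + δ)))
        atTop (𝓝 1)) ∧
      IsGLB {R : ℝ | CodedCaching.DecentralizedAchievable K N M R}
        (CodedCaching.decentralizedLoad K N M)) := by
  refine ⟨fun t ht => ⟨fun B _ hB => CodedCaching.exists_centralizedMAN hK ht hB, ?_⟩,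
    fun M hM0 hM => ⟨fun δ hδ => CodedCaching.tendsto_prob_novelDelivers K hN hM0 hM hδ, ?_⟩⟩
  · exact CodedCaching.isGLB_of_forall
      (fun R hR => CodedCaching.centralizedLoad_le_of_achievable hK hN ht hR)
      fun R hR => CodedCaching.centralizedAchievable_of_lt hK ht hR
  · exact CodedCaching.isGLB_of_forall
      (fun R hR => CodedCaching.decentralizedLoad_le_of_achievable hN hM0 hM hR)
      fun R hR => CodedCaching.decentralizedAchievable_of_lt hN hM0 hM hR
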